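/- Let $\{\rho_\theta;\theta\in\Theta\subset\mathbb{R}^d\}$ be a smooth parametric family of density operators on a finite dimensional Hilbert space $\mathcal H=\mathbb{C}^n$, let $\theta_0$ be an interior point of $\Theta$ with $\rho_{\theta_0}$ strictly positive, and write $\partial_i\rho_{\theta_0}=\frac{\partial}{\partial\theta^i}\rho_\theta|_{\theta=\theta_0}$. An estimator is a pair $(M,\hat\theta)$ of a POVM $M=(M_x)_{x\in\mathcal X}$ on a finite set $\mathcal X$ and a map $\hat\theta:\mathcal X\to\mathbb{R}^d$. It is locally unbiased at $\theta_0$ if $\sum_x\hat\theta^i(x)\,\mathrm{Tr}\,\rho_{\theta_0}M_x=\theta_0^i$ and $\sum_x\hat\theta^i(x)\,\mathrm{Tr}\,\partial_j\rho_{\theta_0}M_x=\delta^i_j$ for all $i,j$. Its covariance matrix $V$ has entries $V_{ij}=\sum_x(\hat\theta^i(x)-\theta_0^i)(\hat\theta^j(x)-\theta_0^j)\,\mathrm{Tr}\,\rho_{\theta_0}M_x$, and the classical Fisher information matrix of $M$ is $$J^{(M)}=\Big[\sum_{x}\frac{(\mathrm{Tr}\,\partial_i\rho_{\theta_0}M_x)(\mathrm{Tr}\,\partial_j\rho_{\theta_0}M_x)}{\mathrm{Tr}\,\rho_{\theta_0}M_x}\Big]_{ij},$$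 where outcomes with $\mathrm{Tr}\,\rho_{\theta_0}M_x=0$ (that is, $M_x=0$) are omitted. Let $P:(0,\infty)\to(0,\infty)$ be an operator monotone function with $P(1)=1$, and let $\mathbf L(X)=\rho_{\theta_0}X$, $\mathbf R(X)=X\rho_{\theta_0}$ be the left and right multiplication super operators. Put $$K^{(P)}(X,Y)=\mathrm{Tr}\,X^*\big[(\mathbf R\,P(\mathbf L\mathbf R^{-1}))^{-1}Y\big],\qquad J^{(P)}=\big[K^{(P)}(\partial_i\rho_{\theta_0},\partial_j\rho_{\theta_0})\big]_{ij},$$ and, for a real symmetric positive semidefinite $d\times d$ matrix $G$, $$C^{(P)}=\mathrm{Tr}\,G J^{(P)-1}+\mathrm{Tr}\,\big|\sqrt G\,\mathrm{Im}(J^{(P)-1})\sqrt G\big| ,\qquad |A|=\sqrt{A^*A}.$$ For $\beta\in[-1,1]$ write $J^{(\beta)}$, $C^{(\beta)}$ for $J^{(P)}$, $C^{(P)}$ with $P(x)=P^{(\beta)}(x)=\frac{1+\beta}{2}x+\frac{1-\beta}{2}$. Theorem. Let $(M,\hat\theta)$ be locally unbiased at $\theta_0$ and let $G$ be a real symmetric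 positive semidefinite $d\times d$ matrix. (i) Let $P:(0,\infty)\to(0,\infty)$ be operator monotone with $P(1)=1$ and $P'(1)=\frac{1+\beta}{2}$, where $\beta\in[-1,1]$. Then $J^{(M)}$, $J^{(|\beta|)}$ and $J^{(P)}$ are positive definite (in particular invertible), and $$\mathrm{Tr}\,GV\ \ge\ \mathrm{Tr}\,GJ^{(M)-1}\ \ge\ C^{(|\beta|)}\ \ge\ C^{(P)}.$$ (ii) The maximum logarithmic derivative bound $\max_{0\le\beta\le1}C^{(\beta)}$ is attained, satisfies $\mathrm{Tr}\,GV\ge\max_{0\le\beta\le1}C^{(\beta)}$, and $\max_{0\le\beta\le1}C^{(\beta)}\ge C^{(P)}$ for every operator monotone $P:(0,\infty)\to(0,\infty)$ with $P(1)=1$. -/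

import Mathlib

open scoped ContDiff ComplexOrder

namespace QuantumEstimation

noncomputable section

/-! Operators on the Hilbert space `ℂⁿ` (with `n` any finite index type) are `Matrix n n ℂ`. -/

/-- Density operator: positive semidefinite with unit trace. -/
structure IsDensity {n : Type*} [Fintype n] (A : Matrix n n ℂ) : Prop where
  posSemidef : A.PosSemidef
  trace_eq_one : A.trace = 1

/-- `{ρ_θ ; θ ∈ Θ}` is a smooth parametric family of density operators, `Θ ⊆ ℝᵈ`. -/
structure IsSmoothModel {n : Type*} [Fintype n] {d : ℕ} (Θ : Set (Fin d → ℝ))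
    (ρ : (Fin d → ℝ) → Matrix n n ℂ) : Prop where
  density : ∀ θ ∈ Θ, IsDensity (ρ θ)
  smooth : ∀ a b : n, ContDiffOn ℝ ∞ (fun θ => ρ θ a b) Θ

/-- The partial derivative `∂ᵢ ρ_θ` at `θ = θ₀`, taken entrywise. -/
def partialDeriv {n : Type*} {d : ℕ} (ρ : (Fin d → ℝ) → Matrix n n ℂ) (θ₀ : Fin d → ℝ)
    (i : Fin d) : Matrix n n ℂ :=
  Matrix.of fun a b => lineDeriv ℝ (fun θ => ρ θ a b) θ₀ (Pi.single i 1)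

/-- A positive operator valued measure on the finite set `X`. -/
structure IsPOVM {n X : Type*} [Fintype n] [DecidableEq n] [Fintype X]
    (M : X → Matrix n n ℂ) : Prop where
  posSemidef : ∀ x, (M x).PosSemidef
  sum_eq_one : ∑ x, M x = 1

/-- `Tr A B` for Hermitian `A`, `B`, as a real number (it is real in that case). -/
def trPair {n : Type*} [Fintype n] (A B : Matrix n n ℂ) : ℝ :=
  (A * B).trace.re

/-- The estimator `(M, θhat)` is locally unbiased at `θ₀`. -/
structure IsLocallyUnbiased {n X : Type*} [Fintype n] [DecidableEq n] [Fintype X] {d : ℕ}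
    (ρ : (Fin d → ℝ) → Matrix n n ℂ) (θ₀ : Fin d → ℝ)
    (M : X → Matrix n n ℂ) (θhat : X → Fin d → ℝ) : Prop where
  povm : IsPOVM M
  mean : ∀ i, ∑ x, θhat x i * trPair (ρ θ₀) (M x) = θ₀ i
  deriv_mean : ∀ i j, ∑ x, θhat x i * trPair (partialDeriv ρ θ₀ j) (M x) =
    if i = j then 1 else 0

/-- The covariance matrix of `(M, θhat)` at `θ₀`, for an estimator with mean `θ₀` there. -/
def covMatrix {n X : Type*} [Fintype n] [Fintype X] {d : ℕ}
    (ρ : (Fin d → ℝ) → Matrix n n ℂ) (θ₀ : Fin d → ℝ)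
    (M : X → Matrix n n ℂ) (θhat : X → Fin d → ℝ) : Matrix (Fin d) (Fin d) ℝ :=
  Matrix.of fun i j =>
    ∑ x, (θhat x i - θ₀ i) * (θhat x j - θ₀ j) * trPair (ρ θ₀) (M x)

/-- The classical Fisher information matrix with respect to the POVM `M`. Outcomes of
probability zero contribute `0` (real division by zero is zero). -/
def classicalFisher {n X : Type*} [Fintype n] [Fintype X] {d : ℕ}
    (ρ : (Fin d → ℝ) → Matrix n n ℂ) (θ₀ : Fin d → ℝ)
    (M : X → Matrix n n ℂ) : Matrix (Fin d) (Fin d) ℝ :=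
  Matrix.of fun i j =>
    ∑ x, trPair (partialDeriv ρ θ₀ i) (M x) * trPair (partialDeriv ρ θ₀ j) (M x) /
      trPair (ρ θ₀) (M x)

/-- `P : (0,∞) → (0,∞)` is operator monotone: it preserves the order of strictly positive
matrices of every size. Only the values of `P` on `(0,∞)` matter. -/
structure IsOperatorMonotone (P : ℝ → ℝ) : Prop where
  pos : ∀ x, 0 < x → 0 < P x
  mono : ∀ (m : ℕ) (A B : Matrix (Fin m) (Fin m) ℂ), A.PosDef → B.PosDef →
    (B - A).PosSemidef → (cfc P B - cfc P A).PosSemidef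

/-- Functional calculus of a super operator `T`: the usual one for Hermitian matrices, applied
to the matrix of `T` in the matrix units, an orthonormal basis for `⟨X, Y⟩ = Tr X* Y`. -/
def superCfc {n : Type*} [Fintype n] [DecidableEq n] (P : ℝ → ℝ)
    (T : Module.End ℂ (Matrix n n ℂ)) : Module.End ℂ (Matrix n n ℂ) :=
  Matrix.toLin (Matrix.stdBasis ℂ n n) (Matrix.stdBasis ℂ n n)
    (cfc P (LinearMap.toMatrix (Matrix.stdBasis ℂ n n) (Matrix.stdBasis ℂ n n) T))

/-- `L_σ : X ↦ σ X`. -/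
def superL {n : Type*} [Fintype n] [DecidableEq n] (σ : Matrix n n ℂ) :
    Module.End ℂ (Matrix n n ℂ) :=
  LinearMap.mulLeft ℂ σ

/-- `R_σ : X ↦ X σ`. -/
def superR {n : Type*} [Fintype n] [DecidableEq n] (σ : Matrix n n ℂ) :
    Module.End ℂ (Matrix n n ℂ) :=
  LinearMap.mulRight ℂ σ

/-- The super operator `(R_σ P(L_σ R_σ⁻¹))⁻¹`. -/
def petzOp {n : Type*} [Fintype n] [DecidableEq n] (P : ℝ → ℝ) (σ : Matrix n n ℂ) :
    Module.End ℂ (Matrix n n ℂ) :=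
  Ring.inverse (superR σ * superCfc P (superL σ * Ring.inverse (superR σ)))

/-- The monotone metric `K_σ^{(P)}(X, Y) = Tr X* [(R_σ P(L_σ R_σ⁻¹))⁻¹ Y]`. -/
def monotoneMetric {n : Type*} [Fintype n] [DecidableEq n] (P : ℝ → ℝ) (σ : Matrix n n ℂ)
    (X Y : Matrix n n ℂ) : ℂ :=
  (X.conjTranspose * petzOp P σ Y).trace

/-- The Fisher information matrix `J^{(P)}` at `θ₀`. -/
def fisherInfo {n : Type*} [Fintype n] [DecidableEq n] {d : ℕ}
    (ρ : (Fin d → ℝ) → Matrix n n ℂ) (θ₀ : Fin d → ℝ) (P : ℝ → ℝ) :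
    Matrix (Fin d) (Fin d) ℂ :=
  Matrix.of fun i j => monotoneMetric P (ρ θ₀) (partialDeriv ρ θ₀ i) (partialDeriv ρ θ₀ j)

/-- `Tr |A|` for a real matrix `A`, with `|A| = √(A* A)`. -/
def trAbs {d : ℕ} (A : Matrix (Fin d) (Fin d) ℝ) : ℝ :=
  (cfc Real.sqrt (A.transpose * A)).trace

/-- `Tr G J⁻¹ + Tr |√G Im(J⁻¹) √G|` for a real matrix `G ≥ 0` and a positive definite complex
matrix `J` (so that `Tr G J⁻¹` is real). -/
def weightedBound {d : ℕ} (G : Matrix (Fin d) (Fin d) ℝ) (J : Matrix (Fin d) (Fin d) ℂ) : ℝ :=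
  (G.map Complex.ofReal * J⁻¹).trace.re +
    trAbs (cfc Real.sqrt G * J⁻¹.map Complex.im * cfc Real.sqrt G)

/-- The bound `C^{(P)}` at `θ₀` with weight `G`. -/
def boundP {n : Type*} [Fintype n] [DecidableEq n] {d : ℕ}
    (ρ : (Fin d → ℝ) → Matrix n n ℂ) (θ₀ : Fin d → ℝ)
    (G : Matrix (Fin d) (Fin d) ℝ) (P : ℝ → ℝ) : ℝ :=
  weightedBound G (fisherInfo ρ θ₀ P)

/-- The linear function `P^{(β)}(x) = (1+β)/2 x + (1-β)/2`. -/
def betaFun (β : ℝ) : ℝ → ℝ := fun x => (1 + β) / 2 * x + (1 - β) / 2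

/-- The bound `C^{(β)} = C^{(P^{(β)})}`. -/
def boundBeta {n : Type*} [Fintype n] [DecidableEq n] {d : ℕ}
    (ρ : (Fin d → ℝ) → Matrix n n ℂ) (θ₀ : Fin d → ℝ)
    (G : Matrix (Fin d) (Fin d) ℝ) (β : ℝ) : ℝ :=
  boundP ρ θ₀ G (betaFun β)

/-- The maximum logarithmic derivative bound `max_{0 ≤ β ≤ 1} C^{(β)}`. -/
def maxLogDerivBound {n : Type*} [Fintype n] [DecidableEq n] {d : ℕ}
    (ρ : (Fin d → ℝ) → Matrix n n ℂ) (θ₀ : Fin d → ℝ)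
    (G : Matrix (Fin d) (Fin d) ℝ) : ℝ :=
  sSup (boundBeta ρ θ₀ G '' Set.Icc 0 1)

end

end QuantumEstimation

open QuantumEstimation

open QuantumEstimation

/-!
All the bounds `C^{(P)}` are compared through the order of the information matrices.

*The bound is antitone in the information.* With `A = √G J⁻¹ √G`, the bound is
`Tr Re A + Tr |Im A|`, and this is the least trace of a real matrix `V` with `A ≤ V`
(`exists_real_ge_trace_eq_holevoValue`, `holevoValue_le_trace`). Since inversion reverses the order,
`J' ≤ t J` implies that the bound of `J` is at most `t` times that of `J'`
(`weightedBound_le_mul`).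

*Classical against quantum.* For a real `J` the bound is `Tr G J⁻¹`, so `Tr G J^{(M)-1} ≥ C^{(β)}`
follows from `J^{(M)} ≤ J^{(β)}`. The latter is proved in `sum_normSq_trace_div_le` from
`⟨X, S⁻¹X⟩ ≥ 2 Re ⟨B, X⟩ - ⟨B, SB⟩` for `S = (1+β)/2 L + (1-β)/2 R`, with `B` a combination of the
`Mₓ`, and a Schwarz inequality for the POVM. The remaining inequality `Tr G V ≥ Tr G J^{(M)-1}` is
the Cramér–Rao inequality `posSemidef_sub_inv_of_mul_eq_one`.

*Operator monotone against linear.* In an eigenbasis of the state, with eigenvalues `p_a`, the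
metric is diagonal with weights `1 / (p_b P(p_a / p_b))` (`petzOp_eq_diagSuper`), so a larger `P`
gives less information and a larger bound. Order preservation for two by two matrices alone
forces `P` to stay below a supporting line at `1` with slope in `[0, 1]`
(`IsOperatorMonotone.exists_supergradient`); this line is some `P^{(β)}`, and its slope is `P'(1)`
where that exists. Hence `C^{(P)} ≤ C^{(β)}`.

*Sign of `β` and the maximum.* The matrices `J^{(-β)}` and `J^{(β)}` are transposes of each other
because the `∂ᵢρ` are Hermitian, so `C^{(β)} = C^{(|β|)}`. On the spectrum of `L R⁻¹` one has
`P^{(β)} ≤ (1 + κ |β - γ|) P^{(γ)}`, which makes `β ↦ C^{(β)}` upper semicontinuous; its supremum on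
the compact interval `[0, 1]` is therefore attained.
-/

namespace QuantumEstimation

open Matrix

/-! ### Functional calculus on eigenvectors -/

/-- Every function agrees with a polynomial on the finite spectrum, so no continuity of `f` is
needed. All functional calculi below are evaluated through this fact. -/
theorem cfc_mulVec_of_eigenvector {𝕜 m : Type*} [RCLike 𝕜] [Fintype m] [DecidableEq m]
    {A : Matrix m m 𝕜} (hA : A.IsHermitian) (f : ℝ → ℝ) {μ : ℝ} {v : m → 𝕜}
    (hv : A *ᵥ v = (μ : 𝕜) • v) : cfc f A *ᵥ v = (f μ : 𝕜) • v := by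
  classical
  have hfin : (spectrum ℝ A).Finite := by
    rw [hA.spectrum_real_eq_range_eigenvalues]
    exact Set.finite_range _
  -- interpolating also at `μ` avoids showing that `μ` lies in the spectrum
  let s : Finset ℝ := insert μ hfin.toFinset
  let q : Polynomial ℝ := Lagrange.interpolate s id f
  have hq : ∀ x ∈ s, q.eval x = f x := fun x hx =>
    Lagrange.eval_interpolate_at_node f (Function.injective_id.injOn) hx
  have h1 : cfc f A = Polynomial.aeval A q := by
    rw [← cfc_polynomial q A hA]
    refine cfc_congr fun x hx => (hq x ?_).symm
    simp [s, hx]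
  have h2 : ∀ p : Polynomial ℝ, Polynomial.aeval A p *ᵥ v = ((p.eval μ : ℝ) : 𝕜) • v := by
    intro p
    induction p using Polynomial.induction_on' with
    | add p q hp hq => simp [Matrix.add_mulVec, hp, hq, add_smul]
    | monomial k c =>
      have hk : ∀ k : ℕ, (A ^ k) *ᵥ v = ((μ : 𝕜) ^ k) • v := by
        intro k
        induction k with
        | zero => simp
        | succ k ih =>
          rw [pow_succ, ← Matrix.mulVec_mulVec, hv, Matrix.mulVec_smul, ih, smul_smul, pow_succ,
            mul_comm]
      rw [Polynomial.aeval_monomial, ← Matrix.mulVec_mulVec, hk, Algebra.algebraMap_eq_smul_one,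
        Matrix.smul_mulVec, Matrix.one_mulVec, Polynomial.eval_monomial,
        RCLike.real_smul_eq_coe_smul (K := 𝕜), smul_smul]
      push_cast
      rfl
  rw [h1, h2, hq μ (by simp [s])]

/-! ### The supporting line of an operator monotone function at `1` -/

/-- Concavity up to an arbitrarily small shift of the argument, from two by two matrices. The matrix
`X` with eigenvalues `a`, `b` and first eigenvector `(r, t)` has upper left entry `r² a + t² b < z`,
hence lies below a diagonal matrix whose first entry is `z`; compare the upper left entries of the
images under `P`. -/
theorem IsOperatorMonotone.sq_convexComb_le {P : ℝ → ℝ} (hP : IsOperatorMonotone P)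
    {a b z r t : ℝ} (ha : 0 < a) (hb : 0 < b) (hrt : r ^ 2 + t ^ 2 = 1)
    (hz : r ^ 2 * a + t ^ 2 * b < z) : r ^ 2 * P a + t ^ 2 * P b ≤ P z := by
  set ε : ℝ := z - (r ^ 2 * a + t ^ 2 * b) with hε
  have hε0 : 0 < ε := by linarith
  set k : ℝ := r * t * (a - b) with hk
  set e : ℝ := t ^ 2 * a + r ^ 2 * b with he
  have hrt' : (r : ℂ) ^ 2 + (t : ℂ) ^ 2 = 1 := by exact_mod_cast hrt
  let W : Matrix (Fin 2) (Fin 2) ℂ := !![(r : ℂ), t; t, -r]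
  have hWW : W * W = 1 := by
    ext i j
    fin_cases i <;> fin_cases j <;> simp [W, Matrix.mul_apply, Fin.sum_univ_two]
    · linear_combination hrt'
    · ring
    · ring
    · linear_combination hrt'
  have hWH : Wᴴ = W := by
    ext i j
    fin_cases i <;> fin_cases j <;> simp [W]
  let X : Matrix (Fin 2) (Fin 2) ℂ :=
    !![((r ^ 2 * a + t ^ 2 * b : ℝ) : ℂ), (k : ℂ); (k : ℂ), (e : ℂ)]
  have hXW : X = Wᴴ * Matrix.diagonal ![(a : ℂ), b] * W := by
    rw [hWH]
    ext i j
    fin_cases i <;> fin_cases j <;>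
      simp [X, W, Matrix.mul_apply, Fin.sum_univ_two, Matrix.vecMul_diagonal, hk, he] <;> ring
  -- the second entry makes the determinant of `Y - X` vanish
  let Y : Matrix (Fin 2) (Fin 2) ℂ := Matrix.diagonal ![(z : ℂ), ((e + k ^ 2 / ε : ℝ) : ℂ)]
  have he0 : 0 < e := by
    rw [he]
    rcases eq_or_ne t 0 with h | h
    · have : r ^ 2 = 1 := by simpa [h] using hrt
      rw [this, h]; simpa using hb
    · positivity
  have hz0 : 0 < z := lt_of_le_of_lt (by positivity) hz
  have hX : X.PosDef := by
    rw [hXW]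
    refine Matrix.PosDef.conjTranspose_mul_mul_same (Matrix.PosDef.diagonal ?_) ?_
    · intro i; fin_cases i <;> simpa
    · intro x y hxy
      have := congrArg (fun v => W *ᵥ v) hxy
      simpa only [Matrix.mulVec_mulVec, hWW, Matrix.one_mulVec] using this
  have hY : Y.PosDef := by
    refine Matrix.PosDef.diagonal ?_
    have : 0 < e + k ^ 2 / ε := by positivity
    intro i
    fin_cases i
    · simpa using hz0
    · exact Complex.zero_lt_real.2 this
  have hYX : (Y - X).PosSemidef := by
    let w : Fin 2 → ℂ := ![1, ((-(k / ε) : ℝ) : ℂ)]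
    have hεk : (ε : ℂ) ≠ 0 := by exact_mod_cast hε0.ne'
    have hεz : (z : ℂ) = ε + (r ^ 2 * a + t ^ 2 * b) := by rw [hε]; push_cast; ring
    have : Y - X = (ε : ℂ) • Matrix.vecMulVec w (star w) := by
      ext i j
      fin_cases i <;> fin_cases j <;>
        simp [X, Y, w, Matrix.vecMulVec, -Complex.coe_smul]
      · rw [hεz]; ring
      · field_simp
      · field_simp
      · field_simp
    rw [this]
    exact (Matrix.posSemidef_vecMulVec_self_star w).smul (by exact_mod_cast hε0.le)
  have key := (hP.mono 2 X Y hX hY hYX).dotProduct_mulVec_nonneg ![1, 0]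
  have hu : X *ᵥ ![(r : ℂ), t] = ((a : ℝ) : ℂ) • ![(r : ℂ), t] := by
    ext i
    fin_cases i <;> simp [X, Matrix.mulVec, dotProduct, Fin.sum_univ_two, hk, he]
    · linear_combination (a : ℂ) * r * hrt'
    · linear_combination (a : ℂ) * t * hrt'
  have hv : X *ᵥ ![(t : ℂ), -r] = ((b : ℝ) : ℂ) • ![(t : ℂ), -r] := by
    ext i
    fin_cases i <;> simp [X, Matrix.mulVec, dotProduct, Fin.sum_univ_two, hk, he]
    · linear_combination (b : ℂ) * t * hrt'
    · linear_combination -(b : ℂ) * r * hrt'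
  have hw : Y *ᵥ ![(1 : ℂ), 0] = ((z : ℝ) : ℂ) • ![(1 : ℂ), 0] := by
    ext i
    fin_cases i <;> simp [Y, Matrix.mulVec, dotProduct, Matrix.diagonal_apply]
  have hu' := cfc_mulVec_of_eigenvector hX.1 P hu
  have hv' := cfc_mulVec_of_eigenvector hX.1 P hv
  have hw' := cfc_mulVec_of_eigenvector hY.1 P hw
  have hdec : ![(1 : ℂ), 0] = (r : ℂ) • ![(r : ℂ), t] + (t : ℂ) • ![(t : ℂ), -r] := by
    ext i
    fin_cases i <;> simp
    · linear_combination -hrt'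
    · ring
  rw [Matrix.sub_mulVec, hw', hdec, Matrix.mulVec_add, Matrix.mulVec_smul, Matrix.mulVec_smul, hu',
    hv', ← hdec] at key
  simp [dotProduct, Fin.sum_univ_two] at key
  have key2 : (((r ^ 2 * P a + t ^ 2 * P b : ℝ)) : ℂ) ≤ ((P z : ℝ) : ℂ) := by
    push_cast
    convert key using 1
    ring
  exact_mod_cast key2

theorem IsOperatorMonotone.convexComb_le {P : ℝ → ℝ} (hP : IsOperatorMonotone P)
    {a b z l : ℝ} (ha : 0 < a) (hb : 0 < b) (hl : 0 ≤ l) (hl1 : l ≤ 1)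
    (hz : l * a + (1 - l) * b < z) : l * P a + (1 - l) * P b ≤ P z := by
  have h1 := Real.sq_sqrt hl
  have h2 := Real.sq_sqrt (sub_nonneg.2 hl1)
  have := hP.sq_convexComb_le (r := √l) (t := √(1 - l)) (z := z) ha hb (by rw [h1, h2]; ring)
    (by rw [h1, h2]; exact hz)
  rwa [h1, h2] at this

theorem IsOperatorMonotone.le_of_lt {P : ℝ → ℝ} (hP : IsOperatorMonotone P) {a z : ℝ}
    (ha : 0 < a) (haz : a < z) : P a ≤ P z := by
  simpa using hP.convexComb_le (l := 1) ha ha zero_le_one le_rfl (by simpa using haz)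

theorem IsOperatorMonotone.slope_le_slope {P : ℝ → ℝ} (hP : IsOperatorMonotone P) {x y : ℝ}
    (hy0 : 0 < y) (hy : y < 1) (hx : 1 < x) :
    (P x - P 1) / (x - 1) ≤ (P 1 - P y) / (1 - y) := by
  have hxy : 0 < x - y := by linarith
  -- mix `x` and `y` to the point `1 - ε < 1` and let `ε → 0`; no continuity of `P` is used
  have hε : ∀ᶠ ε in nhdsWithin (0 : ℝ) (Set.Ioi 0),
      (1 - y - ε) / (x - y) * P x + (1 - (1 - y - ε) / (x - y)) * P y ≤ P 1 := by
    filter_upwards [Ioo_mem_nhdsGT (show (0 : ℝ) < 1 - y by linarith)] with ε hε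
    obtain ⟨h1, h2⟩ := hε
    refine hP.convexComb_le (by linarith) hy0 (div_nonneg (by linarith) hxy.le)
      ((div_le_one hxy).2 (by linarith)) ?_
    have : (1 - y - ε) / (x - y) * x + (1 - (1 - y - ε) / (x - y)) * y = 1 - ε := by
      field_simp; ring
    linarith
  have hlim : Filter.Tendsto (fun ε : ℝ => (1 - y - ε) / (x - y) * P x +
      (1 - (1 - y - ε) / (x - y)) * P y) (nhdsWithin (0 : ℝ) (Set.Ioi 0))
      (nhds ((1 - y - 0) / (x - y) * P x + (1 - (1 - y - 0) / (x - y)) * P y)) := by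
    refine (Continuous.tendsto ?_ 0).mono_left nhdsWithin_le_nhds
    fun_prop
  have h := le_of_tendsto hlim hε
  have h3 : (1 - y - 0) / (x - y) * P x + (1 - (1 - y - 0) / (x - y)) * P y =
      ((1 - y) * P x + (x - 1) * P y) / (x - y) := by
    field_simp; ring
  rw [h3, div_le_iff₀ hxy] at h
  rw [div_le_div_iff₀ (by linarith) (by linarith)]
  nlinarith

/-- The slope `s` is the supremum of the chord slopes to the right of `1`. Monotonicity gives
`0 ≤ s`, positivity of `P` near `0` gives `s ≤ 1`. -/
theorem IsOperatorMonotone.exists_supergradient {P : ℝ → ℝ} (hP : IsOperatorMonotone P)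
    (h1 : P 1 = 1) : ∃ s ∈ Set.Icc (0 : ℝ) 1, ∀ x, 0 < x → P x ≤ 1 + s * (x - 1) := by
  let S : Set ℝ := (fun x => (P x - P 1) / (x - 1)) '' Set.Ioi 1
  have hS : S.Nonempty := Set.Nonempty.image _ ⟨2, by norm_num⟩
  have hub : ∀ y, 0 < y → y < 1 → (P 1 - P y) / (1 - y) ∈ upperBounds S := by
    rintro y hy0 hy _ ⟨x, hx, rfl⟩
    exact hP.slope_le_slope hy0 hy hx
  have hbdd : BddAbove S := ⟨_, hub (1 / 2) (by norm_num) (by norm_num)⟩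
  refine ⟨sSup S, ⟨?_, ?_⟩, ?_⟩
  · refine le_trans ?_ (le_csSup hbdd ⟨2, by norm_num, rfl⟩)
    have := hP.le_of_lt one_pos one_lt_two
    norm_num; linarith
  · -- positivity of `P` bounds the left slope at `y` by `1 / (1 - y)`; let `y → 0`
    have hle : ∀ᶠ y in nhdsWithin (0 : ℝ) (Set.Ioi 0), sSup S ≤ 1 / (1 - y) := by
      filter_upwards [Ioo_mem_nhdsGT (zero_lt_one' ℝ)] with y hy
      refine (csSup_le hS (hub y hy.1 hy.2)).trans ?_
      have := hP.pos y hy.1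
      have : 0 < 1 - y := by linarith [hy.2]
      gcongr
      linarith
    have hlim : Filter.Tendsto (fun y : ℝ => 1 / (1 - y)) (nhdsWithin (0 : ℝ) (Set.Ioi 0))
        (nhds (1 / (1 - 0))) := by
      refine Filter.Tendsto.mono_left ?_ nhdsWithin_le_nhds
      exact ContinuousAt.div continuousAt_const (by fun_prop) (by norm_num)
    simpa using ge_of_tendsto hlim hle
  · intro x hx
    rcases lt_trichotomy x 1 with h | h | h
    · have := csSup_le hS (hub x hx h)
      rw [le_div_iff₀ (by linarith), h1] at this
      linarith
    · simp [h, h1]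
    · have := le_csSup hbdd ⟨x, h, rfl⟩
      simp only at this
      rw [div_le_iff₀ (by linarith), h1] at this
      linarith

/-- The supergradient is the derivative wherever the latter exists, because `P` minus its
supporting line has a local maximum at `1`. -/
theorem IsOperatorMonotone.le_betaFun {P : ℝ → ℝ} (hP : IsOperatorMonotone P)
    (h1 : P 1 = 1) {β : ℝ} (hβ : HasDerivAt P ((1 + β) / 2) 1) :
    ∀ x, 0 < x → P x ≤ betaFun β x := by
  obtain ⟨s, -, hs⟩ := hP.exists_supergradient h1
  have hmax : IsLocalMax (fun x => P x - (1 + s * (x - 1))) 1 := by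
    filter_upwards [lt_mem_nhds (zero_lt_one' ℝ)] with x hx
    have := hs x hx
    simp only [h1]
    linarith
  have hd : HasDerivAt (fun x => P x - (1 + s * (x - 1))) ((1 + β) / 2 - s) 1 := by
    have : HasDerivAt (fun x : ℝ => 1 + s * (x - 1)) s 1 := by
      simpa using (((hasDerivAt_id (1 : ℝ)).sub_const 1).const_mul s).const_add 1
    exact hβ.sub this
  have := hmax.hasDerivAt_eq_zero hd
  intro x hx
  refine (hs x hx).trans (le_of_eq ?_)
  rw [betaFun, show s = (1 + β) / 2 by linarith]
  ring

theorem IsOperatorMonotone.exists_le_betaFun {P : ℝ → ℝ} (hP : IsOperatorMonotone P)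
    (h1 : P 1 = 1) : ∃ β ∈ Set.Icc (-1 : ℝ) 1, ∀ x, 0 < x → P x ≤ betaFun β x := by
  obtain ⟨s, hs01, hs⟩ := hP.exists_supergradient h1
  refine ⟨2 * s - 1, ⟨by linarith [hs01.1], by linarith [hs01.2]⟩, fun x hx => ?_⟩
  refine (hs x hx).trans (le_of_eq ?_)
  rw [betaFun]
  ring

theorem betaFun_pos {β : ℝ} (hβ : β ∈ Set.Icc (-1 : ℝ) 1) {x : ℝ} (hx : 0 < x) :
    0 < betaFun β x := by
  rw [betaFun]
  rcases hβ with ⟨h1, h2⟩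
  rcases h1.eq_or_lt with h | h
  · rw [← h]; norm_num
  · have : 0 < (1 + β) / 2 * x := mul_pos (by linarith) hx
    linarith

/-! ### The monotone metric in an eigenbasis of the state -/

/-- The super operator `X ↦ U (w ∘ (U* X U)) U*`, with `∘` the entrywise product: for unitary `U` it
is diagonal in the matrix units of the basis given by the columns of `U`, with eigenvalues `w`. -/
noncomputable def diagSuper {n : Type*} [Fintype n] (U : Matrix n n ℂ) (w : n → n → ℝ) :
    Module.End ℂ (Matrix n n ℂ) where
  toFun X := U * (Matrix.of fun a b => (w a b : ℂ) * (Uᴴ * X * U) a b) * Uᴴ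
  map_add' X Y := by
    rw [← Matrix.add_mul, ← Matrix.mul_add]
    congr 2
    ext a b
    simp [Matrix.add_mul, mul_add]
  map_smul' c X := by
    rw [RingHom.id_apply, ← Matrix.smul_mul, ← Matrix.mul_smul]
    congr 2
    ext a b
    simp [mul_left_comm]

theorem diagSuper_apply {n : Type*} [Fintype n] (U : Matrix n n ℂ) (w : n → n → ℝ)
    (X : Matrix n n ℂ) :
    diagSuper U w X = U * (Matrix.of fun a b => (w a b : ℂ) * (Uᴴ * X * U) a b) * Uᴴ := rfl

section

variable {n : Type*} [Fintype n] [DecidableEq n] {U : Matrix n n ℂ}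

theorem conj_conj_of_unitary (hU : Uᴴ * U = 1) (Z : Matrix n n ℂ) :
    Uᴴ * (U * Z * Uᴴ) * U = Z := by
  calc Uᴴ * (U * Z * Uᴴ) * U = (Uᴴ * U) * Z * (Uᴴ * U) := by simp only [Matrix.mul_assoc]
    _ = Z := by rw [hU, Matrix.one_mul, Matrix.mul_one]

theorem diagSuper_mul (hU : Uᴴ * U = 1) (w w' : n → n → ℝ) :
    diagSuper U w * diagSuper U w' = diagSuper U (fun a b => w a b * w' a b) := by
  refine LinearMap.ext fun X => ?_
  rw [Module.End.mul_apply, diagSuper_apply, diagSuper_apply, diagSuper_apply,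
    conj_conj_of_unitary hU]
  congr 2
  ext a b
  simp [mul_assoc]

theorem diagSuper_one (hU' : U * Uᴴ = 1) : diagSuper U (fun _ _ => 1) = 1 := by
  refine LinearMap.ext fun X => ?_
  have : (Matrix.of fun a b => ((1 : ℝ) : ℂ) * (Uᴴ * X * U) a b) = Uᴴ * X * U := by
    ext a b; simp
  rw [diagSuper_apply, this]
  calc U * (Uᴴ * X * U) * Uᴴ = (U * Uᴴ) * X * (U * Uᴴ) := by simp only [Matrix.mul_assoc]
    _ = X := by rw [hU', Matrix.one_mul, Matrix.mul_one]

theorem inverse_diagSuper (hU : Uᴴ * U = 1) (hU' : U * Uᴴ = 1) {w : n → n → ℝ}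
    (hw : ∀ a b, w a b ≠ 0) :
    Ring.inverse (diagSuper U w) = diagSuper U (fun a b => (w a b)⁻¹) := by
  have h1 : diagSuper U w * diagSuper U (fun a b => (w a b)⁻¹) = 1 := by
    simp only [diagSuper_mul hU, mul_inv_cancel₀ (hw _ _), diagSuper_one hU']
  have h2 : diagSuper U (fun a b => (w a b)⁻¹) * diagSuper U w = 1 := by
    simp only [diagSuper_mul hU, inv_mul_cancel₀ (hw _ _), diagSuper_one hU']
  exact Ring.inverse_unit ⟨_, _, h1, h2⟩

theorem superL_eq_diagSuper (hU' : U * Uᴴ = 1) {σ : Matrix n n ℂ} {p : n → ℝ}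
    (hσ : σ = U * Matrix.diagonal (fun a => (p a : ℂ)) * Uᴴ) :
    superL σ = diagSuper U (fun a _ => p a) := by
  refine LinearMap.ext fun X => ?_
  have : (Matrix.of fun a b => ((p a : ℝ) : ℂ) * (Uᴴ * X * U) a b) =
      Matrix.diagonal (fun a => (p a : ℂ)) * (Uᴴ * X * U) := by
    ext a b; simp [Matrix.diagonal_mul]
  rw [diagSuper_apply, this, superL, LinearMap.mulLeft_apply, hσ]
  calc U * diagonal (fun a => (p a : ℂ)) * Uᴴ * X =
      U * diagonal (fun a => (p a : ℂ)) * Uᴴ * X * (U * Uᴴ) := by rw [hU', Matrix.mul_one]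
    _ = _ := by simp only [Matrix.mul_assoc]

theorem superR_eq_diagSuper (hU' : U * Uᴴ = 1) {σ : Matrix n n ℂ} {p : n → ℝ}
    (hσ : σ = U * Matrix.diagonal (fun a => (p a : ℂ)) * Uᴴ) :
    superR σ = diagSuper U (fun _ b => p b) := by
  refine LinearMap.ext fun X => ?_
  have : (Matrix.of fun a b => ((p b : ℝ) : ℂ) * (Uᴴ * X * U) a b) =
      (Uᴴ * X * U) * Matrix.diagonal (fun a => (p a : ℂ)) := by
    ext a b; simp [Matrix.mul_diagonal, mul_comm]
  rw [diagSuper_apply, this, superR, LinearMap.mulRight_apply, hσ]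
  calc X * (U * diagonal (fun a => (p a : ℂ)) * Uᴴ) =
      (U * Uᴴ) * X * (U * diagonal (fun a => (p a : ℂ)) * Uᴴ) := by rw [hU', Matrix.one_mul]
    _ = _ := by simp only [Matrix.mul_assoc]

theorem diagSuper_single (hU : Uᴴ * U = 1) (w : n → n → ℝ) (a b : n) :
    diagSuper U w (U * Matrix.single a b 1 * Uᴴ) =
      (w a b : ℂ) • (U * Matrix.single a b 1 * Uᴴ) := by
  rw [diagSuper_apply, conj_conj_of_unitary hU, ← Matrix.smul_mul, ← Matrix.mul_smul]
  congr 2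
  ext c d
  simp only [Matrix.of_apply, Matrix.smul_apply, Matrix.single_apply, smul_eq_mul]
  split_ifs with h
  · rw [h.1, h.2]
  · simp

/-- The functional calculus is void on matrices that are not Hermitian, so this is what gives
`superCfc f (diagSuper U w)` its meaning. -/
theorem isHermitian_toMatrix_diagSuper (w : n → n → ℝ) :
    (LinearMap.toMatrix (Matrix.stdBasis ℂ n n) (Matrix.stdBasis ℂ n n)
      (diagSuper U w)).IsHermitian := by
  have key : ∀ i j : n × n, LinearMap.toMatrix (Matrix.stdBasis ℂ n n) (Matrix.stdBasis ℂ n n)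
      (diagSuper U w) i j = ∑ k, ∑ l, U i.1 k * ((w k l : ℂ) * (star (U j.1 k) * U j.2 l)) *
        star (U i.2 l) := by
    rintro ⟨a, b⟩ ⟨c, d⟩
    have hs : ∀ k l, (Uᴴ * Matrix.single c d (1 : ℂ) * U) k l = star (U c k) * U d l := by
      intro k l
      rw [Matrix.mul_assoc, Matrix.mul_apply, Finset.sum_eq_single c]
      · simp
      · intro x _ hx
        simp [Matrix.single_mul_apply_of_ne _ _ _ _ _ hx]
      · simp
    rw [LinearMap.toMatrix_apply, Matrix.stdBasis_eq_single]
    have hr : ∀ Z : Matrix n n ℂ, (Matrix.stdBasis ℂ n n).repr Z (a, b) = Z a b := by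
      intro Z
      simp [Matrix.stdBasis]
    rw [hr, diagSuper_apply, Matrix.mul_apply, Finset.sum_comm]
    refine Finset.sum_congr rfl fun l _ => ?_
    rw [Matrix.mul_apply, Finset.sum_mul]
    refine Finset.sum_congr rfl fun k _ => ?_
    rw [Matrix.of_apply, hs, Matrix.conjTranspose_apply]
  ext i j
  rw [Matrix.conjTranspose_apply, key, key, star_sum]
  refine Finset.sum_congr rfl fun k _ => ?_
  rw [star_sum]
  refine Finset.sum_congr rfl fun l _ => ?_
  simp only [star_mul', Complex.star_def, Complex.conj_ofReal, Complex.conj_conj]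
  ring

theorem superCfc_apply_of_eigenvector {T : Module.End ℂ (Matrix n n ℂ)}
    (hT : (LinearMap.toMatrix (Matrix.stdBasis ℂ n n) (Matrix.stdBasis ℂ n n) T).IsHermitian)
    (f : ℝ → ℝ) {μ : ℝ} {E : Matrix n n ℂ} (hE : T E = (μ : ℂ) • E) :
    superCfc f T E = (f μ : ℂ) • E := by
  have h1 : LinearMap.toMatrix (Matrix.stdBasis ℂ n n) (Matrix.stdBasis ℂ n n) T *ᵥ
      ⇑((Matrix.stdBasis ℂ n n).repr E) = (μ : ℂ) • ⇑((Matrix.stdBasis ℂ n n).repr E) := by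
    rw [LinearMap.toMatrix_mulVec_repr, hE, map_smul, Finsupp.coe_smul]
  have h2 := cfc_mulVec_of_eigenvector hT f h1
  refine (Matrix.stdBasis ℂ n n).repr.injective (DFunLike.coe_injective ?_)
  rw [map_smul, Finsupp.coe_smul, ← LinearMap.toMatrix_mulVec_repr (Matrix.stdBasis ℂ n n)
    (Matrix.stdBasis ℂ n n), superCfc, LinearMap.toMatrix_toLin]
  exact h2

theorem linearMap_ext_of_unitary (hU' : U * Uᴴ = 1) {S T : Module.End ℂ (Matrix n n ℂ)}
    (h : ∀ a b, S (U * Matrix.single a b 1 * Uᴴ) = T (U * Matrix.single a b 1 * Uᴴ)) : S = T := by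
  have hX : ∀ X : Matrix n n ℂ, U * (Uᴴ * X * U) * Uᴴ = X := fun X => by
    calc U * (Uᴴ * X * U) * Uᴴ = (U * Uᴴ) * X * (U * Uᴴ) := by simp only [Matrix.mul_assoc]
      _ = X := by rw [hU', Matrix.one_mul, Matrix.mul_one]
  refine LinearMap.ext fun X => ?_
  rw [← hX X, Matrix.matrix_eq_sum_single (Uᴴ * X * U)]
  simp only [Matrix.mul_sum, Matrix.sum_mul, map_sum]
  refine Finset.sum_congr rfl fun a _ => Finset.sum_congr rfl fun b _ => ?_
  have hs : ∀ c : ℂ, U * Matrix.single a b c * Uᴴ = c • (U * Matrix.single a b 1 * Uᴴ) := by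
    intro c
    rw [← Matrix.smul_mul, ← Matrix.mul_smul, Matrix.smul_single, smul_eq_mul, mul_one]
  rw [hs, map_smul, map_smul, h]

theorem superCfc_diagSuper (hU : Uᴴ * U = 1) (hU' : U * Uᴴ = 1) (f : ℝ → ℝ) (w : n → n → ℝ) :
    superCfc f (diagSuper U w) = diagSuper U (fun a b => f (w a b)) := by
  refine linearMap_ext_of_unitary hU' fun a b => ?_
  rw [superCfc_apply_of_eigenvector (isHermitian_toMatrix_diagSuper w) f
    (diagSuper_single hU w a b), diagSuper_single hU]

theorem petzOp_eq_diagSuper (hU : Uᴴ * U = 1) (hU' : U * Uᴴ = 1) {σ : Matrix n n ℂ} {p : n → ℝ}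
    (hσ : σ = U * Matrix.diagonal (fun a => (p a : ℂ)) * Uᴴ) (hp : ∀ a, 0 < p a) {P : ℝ → ℝ}
    (hP : ∀ x, 0 < x → 0 < P x) :
    petzOp P σ = diagSuper U (fun a b => (p b * P (p a / p b))⁻¹) := by
  rw [petzOp, superL_eq_diagSuper hU' hσ, superR_eq_diagSuper hU' hσ,
    inverse_diagSuper hU hU' (fun _ b => (hp b).ne'), diagSuper_mul hU,
    superCfc_diagSuper hU hU', diagSuper_mul hU, inverse_diagSuper hU hU']
  · simp only [div_eq_mul_inv]
  · exact fun a b => (mul_pos (hp b) (hP _ (mul_pos (hp a) (inv_pos.2 (hp b))))).ne'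

end

theorem trace_conjTranspose_mul_diagSuper {n : Type*} [Fintype n] (U : Matrix n n ℂ)
    (w : n → n → ℝ) (X Y : Matrix n n ℂ) :
    (Xᴴ * diagSuper U w Y).trace =
      ∑ a, ∑ b, star ((Uᴴ * X * U) a b) * ((w a b : ℂ) * (Uᴴ * Y * U) a b) := by
  have : (Xᴴ * diagSuper U w Y).trace =
      ((Uᴴ * X * U)ᴴ * (Matrix.of fun a b => (w a b : ℂ) * (Uᴴ * Y * U) a b)).trace := by
    rw [diagSuper_apply, ← Matrix.mul_assoc, Matrix.trace_mul_comm]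
    simp only [Matrix.conjTranspose_mul, Matrix.conjTranspose_conjTranspose, Matrix.mul_assoc]
  rw [this, Matrix.trace, Finset.sum_comm]
  refine Finset.sum_congr rfl fun b _ => ?_
  rw [Matrix.diag_apply, Matrix.mul_apply]
  rfl

/-- The `i`-th column holds the entries of `U* D i U`. -/
noncomputable def entryMatrix {n ι : Type*} [Fintype n] (U : Matrix n n ℂ)
    (D : ι → Matrix n n ℂ) : Matrix (n × n) ι ℂ :=
  Matrix.of fun ab i => (Uᴴ * D i * U) ab.1 ab.2

theorem entryMatrix_mulVec {n ι : Type*} [Fintype n] [Fintype ι] (U : Matrix n n ℂ)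
    (D : ι → Matrix n n ℂ) (u : ι → ℂ) (ab : n × n) :
    (entryMatrix U D *ᵥ u) ab = (Uᴴ * (∑ i, u i • D i) * U) ab.1 ab.2 := by
  rw [Matrix.mul_sum, Matrix.sum_mul, Matrix.sum_apply, Matrix.mulVec, dotProduct]
  refine Finset.sum_congr rfl fun i _ => ?_
  simp [entryMatrix, mul_comm]

/-- The Fisher information is a Gram matrix whose weights `1 / (p_b P(p_a / p_b))` decrease as `P`
grows. -/
theorem fisherInfo_eq {n : Type*} [Fintype n] [DecidableEq n] {d : ℕ}
    {ρ : (Fin d → ℝ) → Matrix n n ℂ} {θ₀ : Fin d → ℝ} {U : Matrix n n ℂ}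
    (hU : Uᴴ * U = 1) (hU' : U * Uᴴ = 1) {p : n → ℝ}
    (hσ : ρ θ₀ = U * Matrix.diagonal (fun a => (p a : ℂ)) * Uᴴ) (hp : ∀ a, 0 < p a) {P : ℝ → ℝ}
    (hP : ∀ x, 0 < x → 0 < P x) :
    fisherInfo ρ θ₀ P = (entryMatrix U (partialDeriv ρ θ₀))ᴴ *
      Matrix.diagonal (fun ab : n × n => (((p ab.2 * P (p ab.1 / p ab.2))⁻¹ : ℝ) : ℂ)) *
      entryMatrix U (partialDeriv ρ θ₀) := by
  ext i j
  rw [fisherInfo, Matrix.of_apply, monotoneMetric, petzOp_eq_diagSuper hU hU' hσ hp hP,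
    trace_conjTranspose_mul_diagSuper,
    Matrix.mul_assoc _ (Matrix.diagonal _), Matrix.mul_apply, Fintype.sum_prod_type]
  refine Finset.sum_congr rfl fun a _ => Finset.sum_congr rfl fun b _ => ?_
  rw [Matrix.diagonal_mul]
  rfl

theorem exists_diagonalization {n : Type*} [Fintype n] [DecidableEq n] {σ : Matrix n n ℂ}
    (hσ : σ.PosDef) : ∃ (U : Matrix n n ℂ) (p : n → ℝ), Uᴴ * U = 1 ∧ U * Uᴴ = 1 ∧
      σ = U * Matrix.diagonal (fun a => (p a : ℂ)) * Uᴴ ∧ ∀ a, 0 < p a := by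
  refine ⟨hσ.1.eigenvectorUnitary, hσ.1.eigenvalues, ?_, ?_, ?_, hσ.eigenvalues_pos⟩
  · exact Unitary.coe_star_mul_self hσ.1.eigenvectorUnitary
  · exact Unitary.coe_mul_star_self hσ.1.eigenvectorUnitary
  · exact hσ.1.spectral_theorem

/-! ### The weighted bound as a minimum over real majorants -/

section

variable {m : Type*} [Fintype m] [DecidableEq m]

theorem map_ofReal_cfc {A : Matrix m m ℝ} (hA : A.IsHermitian) (f : ℝ → ℝ) :
    (cfc f A).map Complex.ofReal = cfc f (A.map Complex.ofReal) := by
  classical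
  have hAc : (A.map Complex.ofReal).IsHermitian := by
    ext i j
    simpa using congrArg Complex.ofReal (hA.apply i j)
  have hfin : (spectrum ℝ A).Finite := by
    rw [hA.spectrum_real_eq_range_eigenvalues]
    exact Set.finite_range _
  have hfin' : (spectrum ℝ (A.map Complex.ofReal)).Finite := by
    rw [hAc.spectrum_real_eq_range_eigenvalues]
    exact Set.finite_range _
  -- one polynomial that agrees with `f` on both spectra
  let s : Finset ℝ := hfin.toFinset ∪ hfin'.toFinset
  let q : Polynomial ℝ := Lagrange.interpolate s id f
  have hq : ∀ x ∈ s, q.eval x = f x := fun x hx =>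
    Lagrange.eval_interpolate_at_node f (Function.injective_id.injOn) hx
  have h1 : cfc f A = Polynomial.aeval A q := by
    rw [← cfc_polynomial q A hA]
    exact cfc_congr fun x hx => (hq x (by simp [s, hx])).symm
  have h2 : cfc f (A.map Complex.ofReal) = Polynomial.aeval (A.map Complex.ofReal) q := by
    rw [← cfc_polynomial q (A.map Complex.ofReal) hAc]
    exact cfc_congr fun x hx => (hq x (by simp [s, hx])).symm
  rw [h1, h2]
  exact (Polynomial.aeval_algHom_apply Complex.ofRealAm.mapMatrix A q).symm

theorem eq_conj_diagonal_of_eigenvectors {U M : Matrix m m ℂ} (hU' : U * Uᴴ = 1) {μ : m → ℂ}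
    (h : ∀ k, M *ᵥ (fun i => U i k) = μ k • fun i => U i k) :
    M = U * Matrix.diagonal μ * Uᴴ := by
  have : M * U = U * Matrix.diagonal μ := by
    ext i k
    rw [Matrix.mul_diagonal, mul_comm]
    exact congrFun (h k) i
  rw [← this, Matrix.mul_assoc, hU', Matrix.mul_one]

theorem map_re_add_I_smul_map_im {m : Type*} (H : Matrix m m ℂ) :
    (H.map Complex.re).map Complex.ofReal +
      Complex.I • (H.map Complex.im).map Complex.ofReal = H := by
  ext i j
  simp [mul_comm Complex.I, Complex.re_add_im]

theorem transpose_map_im {m : Type*} {H : Matrix m m ℂ} (hH : H.IsHermitian) :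
    (H.map Complex.im)ᵀ = -H.map Complex.im := by
  ext i j
  have := congrArg Complex.im (hH.apply i j)
  simp only [Complex.star_def, Complex.conj_im] at this
  simp only [Matrix.transpose_apply, Matrix.map_apply, Matrix.neg_apply]
  linarith

/-- Simultaneous diagonalization of `i N` and `|N|` for a real antisymmetric matrix `N`. -/
theorem exists_diagonalization_abs {N : Matrix m m ℝ} (hN : Nᵀ = -N) :
    ∃ (U : Matrix m m ℂ) (l : m → ℝ), Uᴴ * U = 1 ∧ U * Uᴴ = 1 ∧
      Complex.I • N.map Complex.ofReal = U * Matrix.diagonal (fun k => (l k : ℂ)) * Uᴴ ∧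
      (cfc Real.sqrt (Nᵀ * N)).map Complex.ofReal =
        U * Matrix.diagonal (fun k => ((|l k| : ℝ) : ℂ)) * Uᴴ := by
  set K : Matrix m m ℂ := Complex.I • N.map Complex.ofReal with hKdef
  have hK : K.IsHermitian := by
    ext i j
    have h := congrArg Complex.ofReal (congrFun (congrFun hN i) j)
    simp only [Matrix.transpose_apply, Matrix.neg_apply, Complex.ofReal_neg] at h
    simp [hKdef, h]
  have hKK : (Nᵀ * N).map Complex.ofReal = K * K := by
    rw [hN, hKdef, Matrix.smul_mul, Matrix.mul_smul, smul_smul, Complex.I_mul_I]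
    ext i j
    simp [Matrix.mul_apply]
  have hNN : (Nᵀ * N).IsHermitian := by
    simpa using Matrix.isHermitian_conjTranspose_mul_self N
  have hU := Unitary.coe_star_mul_self hK.eigenvectorUnitary
  have hU' := Unitary.coe_mul_star_self hK.eigenvectorUnitary
  refine ⟨hK.eigenvectorUnitary, hK.eigenvalues, hU, hU', hK.spectral_theorem, ?_⟩
  refine eq_conj_diagonal_of_eigenvectors hU' fun k => ?_
  rw [map_ofReal_cfc hNN, hKK]
  have hcol : (fun i => (hK.eigenvectorUnitary : Matrix m m ℂ) i k) =
      ⇑(hK.eigenvectorBasis k) := by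
    ext i
    rw [hK.eigenvectorUnitary_apply]
  have hk : K *ᵥ ⇑(hK.eigenvectorBasis k) =
      ((hK.eigenvalues k : ℝ) : ℂ) • ⇑(hK.eigenvectorBasis k) := by
    rw [hK.mulVec_eigenvectorBasis k]
    rfl
  have hk2 : (K * K) *ᵥ ⇑(hK.eigenvectorBasis k) =
      ((hK.eigenvalues k ^ 2 : ℝ) : ℂ) • ⇑(hK.eigenvectorBasis k) := by
    rw [← Matrix.mulVec_mulVec, hk, Matrix.mulVec_smul, hk, smul_smul]
    push_cast
    rw [sq]
  have hKKh : (K * K).IsHermitian := by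
    have := Matrix.isHermitian_conjTranspose_mul_self K
    rwa [hK.eq] at this
  rw [hcol, ← Real.sqrt_sq_eq_abs]
  exact cfc_mulVec_of_eigenvector hKKh Real.sqrt hk2

end

/-- `Tr Re H + Tr |Im H|`, for a Hermitian matrix `H`. -/
noncomputable def holevoValue {d : ℕ} (H : Matrix (Fin d) (Fin d) ℂ) : ℝ :=
  H.trace.re + trAbs (H.map Complex.im)

/-- The majorant is `Re H + |Im H|`, by `i Im H ≤ |Im H|`. -/
theorem exists_real_ge_trace_eq_holevoValue {d : ℕ} {H : Matrix (Fin d) (Fin d) ℂ}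
    (hH : H.IsHermitian) : ∃ V : Matrix (Fin d) (Fin d) ℝ,
      (V.map Complex.ofReal - H).PosSemidef ∧ V.trace = holevoValue H := by
  obtain ⟨U, l, hU, hU', hK, hR⟩ := exists_diagonalization_abs (transpose_map_im hH)
  refine ⟨H.map Complex.re + cfc Real.sqrt ((H.map Complex.im)ᵀ * H.map Complex.im), ?_, ?_⟩
  · have h : (H.map Complex.re + cfc Real.sqrt ((H.map Complex.im)ᵀ * H.map Complex.im)).map
        Complex.ofReal - H = U * Matrix.diagonal (fun k => ((|l k| - l k : ℝ) : ℂ)) * Uᴴ := by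
      conv_lhs =>
        enter [2]
        rw [← map_re_add_I_smul_map_im H]
      rw [Matrix.map_add _ Complex.ofReal_add, hR, hK, add_sub_add_left_eq_sub, ← Matrix.sub_mul,
        ← Matrix.mul_sub, Matrix.diagonal_sub]
      simp
    rw [h]
    refine (Matrix.PosSemidef.diagonal fun k => ?_).mul_mul_conjTranspose_same U
    exact Complex.zero_le_real.2 (sub_nonneg.2 (le_abs_self _))
  · rw [Matrix.trace_add, holevoValue, trAbs]
    congr 1
    simp [Matrix.trace]

/-- Together with `exists_real_ge_trace_eq_holevoValue`: the value is the least trace of a real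
matrix above `H`. Both `V - Re H ± i Im H` are positive semidefinite, so in an eigenbasis of
`i Im H` the diagonal of `V - Re H` dominates the moduli of the eigenvalues. -/
theorem holevoValue_le_trace {d : ℕ} {H : Matrix (Fin d) (Fin d) ℂ} (hH : H.IsHermitian)
    {V : Matrix (Fin d) (Fin d) ℝ} (hV : (V.map Complex.ofReal - H).PosSemidef) :
    holevoValue H ≤ V.trace := by
  obtain ⟨U, l, hU, hU', hK, hR⟩ := exists_diagonalization_abs (transpose_map_im hH)
  set K : Matrix (Fin d) (Fin d) ℂ := Complex.I • (H.map Complex.im).map Complex.ofReal with hKdef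
  set R := cfc Real.sqrt ((H.map Complex.im)ᵀ * H.map Complex.im)
  set Q : Matrix (Fin d) (Fin d) ℂ := V.map Complex.ofReal - (H.map Complex.re).map Complex.ofReal
    with hQ
  have hVH : V.map Complex.ofReal - H = Q - K := by
    conv_lhs => rw [← map_re_add_I_smul_map_im H]
    rw [hQ, hKdef]
    abel
  rw [hVH] at hV
  have hKh : K.IsHermitian := by
    rw [hK]
    have : (Matrix.diagonal (fun k => (l k : ℂ))).IsHermitian :=
      Matrix.isHermitian_diagonal_of_self_adjoint _ (by ext; simp)
    exact Matrix.isHermitian_mul_mul_conjTranspose U this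
  have hQh : Q.IsHermitian := by
    have := hV.1.add hKh
    rwa [sub_add_cancel] at this
  -- `Q` is real symmetric and `K` antisymmetric, so transposing gives `Q + K ≥ 0`
  have hV' : (Q + K).PosSemidef := by
    have h := hV.transpose
    have hQt : Qᵀ = Q := by
      conv_rhs => rw [← hQh.eq]
      ext i j
      simp [hQ]
    have hKt : Kᵀ = -K := by
      rw [hKdef, Matrix.transpose_smul, ← Matrix.transpose_map, transpose_map_im hH]
      ext i j
      simp
    rwa [Matrix.transpose_sub, hQt, hKt, sub_neg_eq_add] at h
  have hKd : Uᴴ * K * U = Matrix.diagonal (fun k => (l k : ℂ)) := by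
    rw [hK, conj_conj_of_unitary hU]
  have hdiag : ∀ k, |l k| ≤ ((Uᴴ * Q * U) k k).re := by
    intro k
    have h1 := (hV.conjTranspose_mul_mul_same U).diag_nonneg (i := k)
    have h2 := (hV'.conjTranspose_mul_mul_same U).diag_nonneg (i := k)
    rw [Matrix.mul_sub, Matrix.sub_mul, hKd] at h1
    rw [Matrix.mul_add, Matrix.add_mul, hKd] at h2
    have h1' := (Complex.le_def.1 h1).1
    have h2' := (Complex.le_def.1 h2).1
    simp at h1' h2'
    exact abs_le.2 ⟨by linarith, by linarith⟩
  have htr : (Uᴴ * Q * U).trace.re = V.trace - H.trace.re := by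
    rw [Matrix.trace_mul_comm, ← Matrix.mul_assoc, hU', Matrix.one_mul, hQ]
    simp [Matrix.trace]
  have htrR : R.trace = ∑ k, |l k| := by
    have h1 : (R.map Complex.ofReal).trace = ∑ k, ((|l k| : ℝ) : ℂ) := by
      rw [hR, Matrix.trace_mul_comm, ← Matrix.mul_assoc, hU, Matrix.one_mul, Matrix.trace_diagonal]
    have h2 : (R.map Complex.ofReal).trace = ((R.trace : ℝ) : ℂ) := by
      simp [Matrix.trace]
    rw [h2] at h1
    exact_mod_cast h1
  have hsum : ∑ k, |l k| ≤ (Uᴴ * Q * U).trace.re := by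
    rw [Matrix.trace, Complex.re_sum]
    exact Finset.sum_le_sum fun k _ => hdiag k
  have : trAbs (H.map Complex.im) = R.trace := rfl
  rw [holevoValue, this, htrR]
  linarith

theorem holevoValue_le_mul {d : ℕ} {A B : Matrix (Fin d) (Fin d) ℂ} (hA : A.IsHermitian)
    (hB : B.IsHermitian) {t : ℝ} (ht : 0 ≤ t) (h : ((t : ℂ) • B - A).PosSemidef) :
    holevoValue A ≤ t * holevoValue B := by
  obtain ⟨V, hV, htr⟩ := exists_real_ge_trace_eq_holevoValue hB
  rw [← htr, ← smul_eq_mul, ← Matrix.trace_smul]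
  refine holevoValue_le_trace hA ?_
  have h1 : (t • V).map Complex.ofReal - A =
      (t : ℂ) • (V.map Complex.ofReal - B) + ((t : ℂ) • B - A) := by
    ext i j
    simp
    ring
  rw [h1]
  exact (hV.smul (Complex.zero_le_real.2 ht)).add h

/-- The inverse reverses the order: `B ≤ t A` gives `A⁻¹ ≤ t B⁻¹`. -/
theorem posSemidef_smul_inv_sub_inv {m : Type*} [Fintype m] [DecidableEq m] {A B : Matrix m m ℂ}
    (hA : A.PosDef) (hB : B.PosDef) {t : ℝ} (ht : 0 < t) (h : ((t : ℂ) • A - B).PosSemidef) :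
    ((t : ℂ) • B⁻¹ - A⁻¹).PosSemidef := by
  have htc : (t : ℂ) ≠ 0 := by exact_mod_cast ht.ne'
  have hA1 : A⁻¹ * A = 1 := Matrix.nonsing_inv_mul _ ((Matrix.isUnit_iff_isUnit_det _).1 hA.isUnit)
  have hB1 : B⁻¹ * B = 1 := Matrix.nonsing_inv_mul _ ((Matrix.isUnit_iff_isUnit_det _).1 hB.isUnit)
  have hB2 : B * B⁻¹ = 1 := Matrix.mul_nonsing_inv _ ((Matrix.isUnit_iff_isUnit_det _).1 hB.isUnit)
  have hAi := hA.inv.1.eq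
  have hBi := hB.inv.1.eq
  -- completing the square: `(A⁻¹ - t B⁻¹) B (A⁻¹ - t B⁻¹) + A⁻¹ (t A - B) A⁻¹ = t (t B⁻¹ - A⁻¹)`
  have h1 := (hB.posSemidef.conjTranspose_mul_mul_same (A⁻¹ - (t : ℂ) • B⁻¹)).add
    (h.conjTranspose_mul_mul_same A⁻¹)
  have h2 : (A⁻¹ - (t : ℂ) • B⁻¹)ᴴ * B * (A⁻¹ - (t : ℂ) • B⁻¹) +
      (A⁻¹)ᴴ * ((t : ℂ) • A - B) * A⁻¹ = (t : ℂ) • ((t : ℂ) • B⁻¹ - A⁻¹) := by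
    rw [Matrix.conjTranspose_sub, Matrix.conjTranspose_smul, hAi, hBi, Complex.star_def,
      Complex.conj_ofReal]
    have e1 : (A⁻¹ - (t : ℂ) • B⁻¹) * B = A⁻¹ * B - (t : ℂ) • 1 := by
      rw [Matrix.sub_mul, Matrix.smul_mul, hB1]
    have e2 : A⁻¹ * ((t : ℂ) • A - B) = (t : ℂ) • 1 - A⁻¹ * B := by
      rw [Matrix.mul_sub, Matrix.mul_smul, hA1]
    have e3 : A⁻¹ * B * B⁻¹ = A⁻¹ := by rw [Matrix.mul_assoc, hB2, Matrix.mul_one]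
    rw [e1, e2]
    simp only [Matrix.sub_mul, Matrix.mul_sub, Matrix.smul_mul, Matrix.mul_smul, Matrix.one_mul,
      e3, smul_sub]
    abel
  rw [h2] at h1
  have h3 := h1.smul (Complex.zero_le_real.2 (inv_nonneg.2 ht.le))
  rwa [smul_smul, Complex.ofReal_inv, inv_mul_cancel₀ htc, one_smul] at h3

theorem isHermitian_cfc {m : Type*} [Fintype m] [DecidableEq m] (f : ℝ → ℝ) (A : Matrix m m ℝ) :
    (cfc f A).IsHermitian := cfc_predicate f A

theorem cfc_sqrt_mul_cfc_sqrt {m : Type*} [Fintype m] [DecidableEq m] {G : Matrix m m ℝ}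
    (hG : G.PosSemidef) : cfc Real.sqrt G * cfc Real.sqrt G = G := by
  rw [← cfc_mul Real.sqrt Real.sqrt G]
  conv_rhs => rw [← cfc_id ℝ G hG.1]
  refine cfc_congr fun x hx => ?_
  rw [hG.1.spectrum_real_eq_range_eigenvalues] at hx
  obtain ⟨i, rfl⟩ := hx
  exact Real.mul_self_sqrt (hG.eigenvalues_nonneg i)

theorem weightedBound_eq_holevoValue {d : ℕ} {G : Matrix (Fin d) (Fin d) ℝ} (hG : G.PosSemidef)
    (J : Matrix (Fin d) (Fin d) ℂ) :
    weightedBound G J = holevoValue ((cfc Real.sqrt G).map Complex.ofReal * J⁻¹ *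
      (cfc Real.sqrt G).map Complex.ofReal) := by
  set S := cfc Real.sqrt G with hS
  have h1 : G.map Complex.ofReal = S.map Complex.ofReal * S.map Complex.ofReal := by
    conv_lhs => rw [← cfc_sqrt_mul_cfc_sqrt hG]
    ext i j
    simp [Matrix.mul_apply, ← hS]
  have h2 : (S.map Complex.ofReal * J⁻¹ * S.map Complex.ofReal).map Complex.im =
      S * J⁻¹.map Complex.im * S := by
    ext i j
    simp [Matrix.mul_apply]
  rw [weightedBound, holevoValue, h2, h1, Matrix.mul_assoc, Matrix.trace_mul_comm]

/-- The bound decreases as the information grows. The factor `t` yields the continuity in `β` that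
attainment of the maximum needs. -/
theorem weightedBound_le_mul {d : ℕ} {G : Matrix (Fin d) (Fin d) ℝ} (hG : G.PosSemidef)
    {A B : Matrix (Fin d) (Fin d) ℂ} (hA : A.PosDef) (hB : B.PosDef) {t : ℝ} (ht : 0 < t)
    (h : ((t : ℂ) • A - B).PosSemidef) : weightedBound G A ≤ t * weightedBound G B := by
  set S := (cfc Real.sqrt G).map Complex.ofReal with hS
  have hSh : S.IsHermitian := by
    ext i j
    simpa [hS] using congrArg Complex.ofReal ((isHermitian_cfc Real.sqrt G).apply i j)
  have key : ∀ J : Matrix (Fin d) (Fin d) ℂ, J.PosSemidef → (S * J * S).PosSemidef := by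
    intro J hJ
    have := hJ.mul_mul_conjTranspose_same S
    rwa [hSh.eq] at this
  rw [weightedBound_eq_holevoValue hG, weightedBound_eq_holevoValue hG]
  refine holevoValue_le_mul (key _ hA.inv.posSemidef).1 (key _ hB.inv.posSemidef).1 ht.le ?_
  have := key _ (posSemidef_smul_inv_sub_inv hA hB ht h)
  rwa [Matrix.mul_sub, Matrix.sub_mul, Matrix.mul_smul, Matrix.smul_mul] at this

/-! ### Traces of products -/

open scoped MatrixOrder in
theorem exists_eq_conjTranspose_mul_self {𝕜 m : Type*} [RCLike 𝕜] [Fintype m]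
    {A : Matrix m m 𝕜} (hA : A.PosSemidef) : ∃ B : Matrix m m 𝕜, A = Bᴴ * B := by
  classical
  exact CStarAlgebra.nonneg_iff_eq_star_mul_self.1 hA.nonneg

theorem trace_mul_nonneg {𝕜 m : Type*} [RCLike 𝕜] [Fintype m]
    {A B : Matrix m m 𝕜} (hA : A.PosSemidef) (hB : B.PosSemidef) : 0 ≤ (A * B).trace := by
  obtain ⟨C, rfl⟩ := exists_eq_conjTranspose_mul_self hA
  rw [Matrix.trace_mul_comm, ← Matrix.mul_assoc, Matrix.trace_mul_comm, ← Matrix.mul_assoc]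
  exact (hB.mul_mul_conjTranspose_same C).trace_nonneg

theorem eq_zero_of_trace_mul_eq_zero {m : Type*} [Fintype m] [DecidableEq m]
    {A B : Matrix m m ℂ} (hA : A.PosDef) (hB : B.PosSemidef) (h : (A * B).trace = 0) : B = 0 := by
  obtain ⟨C, hC⟩ := exists_eq_conjTranspose_mul_self hA.posSemidef
  obtain ⟨D, rfl⟩ := exists_eq_conjTranspose_mul_self hB
  have h1 : ((C * Dᴴ)ᴴ * (C * Dᴴ)).trace = 0 := by
    rw [← h, hC, Matrix.trace_mul_comm (Cᴴ * C)]
    rw [Matrix.conjTranspose_mul, Matrix.conjTranspose_conjTranspose]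
    rw [Matrix.mul_assoc Dᴴ D, Matrix.trace_mul_comm Dᴴ]
    simp only [Matrix.mul_assoc]
  have h2 : C * Dᴴ = 0 := Matrix.trace_conjTranspose_mul_self_eq_zero_iff.1 h1
  have h3 : A * Dᴴ = 0 := by rw [hC, Matrix.mul_assoc, h2, Matrix.mul_zero]
  have h4 : Dᴴ = 0 := by
    have := congrArg (fun Z => A⁻¹ * Z) h3
    simpa [← Matrix.mul_assoc,
      Matrix.nonsing_inv_mul _ ((Matrix.isUnit_iff_isUnit_det _).1 hA.isUnit)] using this
  rw [h4, Matrix.zero_mul]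

theorem trPair_nonneg {m : Type*} [Fintype m] {A B : Matrix m m ℂ} (hA : A.PosSemidef)
    (hB : B.PosSemidef) : 0 ≤ trPair A B :=
  (Complex.le_def.1 (trace_mul_nonneg hA hB)).1

theorem ofReal_trPair {m : Type*} [Fintype m] {A B : Matrix m m ℂ} (hA : A.IsHermitian)
    (hB : B.IsHermitian) : (trPair A B : ℂ) = (A * B).trace := by
  refine Complex.conj_eq_iff_re.1 ?_
  rw [← Complex.star_def, ← Matrix.trace_conjTranspose, Matrix.conjTranspose_mul, hA.eq, hB.eq,
    Matrix.trace_mul_comm]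

/-! ### The derivatives of the model -/

section

variable {n : Type*} [Fintype n] {d : ℕ} {Θ : Set (Fin d → ℝ)}
  {ρ : (Fin d → ℝ) → Matrix n n ℂ} {θ₀ : Fin d → ℝ}

theorem IsSmoothModel.isHermitian_partialDeriv (hmodel : IsSmoothModel Θ ρ)
    (hθ₀ : θ₀ ∈ interior Θ) (i : Fin d) : (partialDeriv ρ θ₀ i).IsHermitian := by
  ext a b
  rw [Matrix.conjTranspose_apply, partialDeriv, Matrix.of_apply, Matrix.of_apply]
  have h1 : (fun θ => ρ θ a b) =ᶠ[nhds θ₀] fun θ => star (ρ θ b a) := by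
    filter_upwards [mem_interior_iff_mem_nhds.1 hθ₀] with θ hθ
    exact ((hmodel.density θ hθ).posSemidef.1.apply a b).symm
  rw [h1.lineDeriv_eq]
  exact deriv.star.symm

theorem IsSmoothModel.trace_partialDeriv (hmodel : IsSmoothModel Θ ρ)
    (hθ₀ : θ₀ ∈ interior Θ) (i : Fin d) : (partialDeriv ρ θ₀ i).trace = 0 := by
  have hd : ∀ a, LineDifferentiableAt ℝ (fun θ => ρ θ a a) θ₀ (Pi.single i 1) := fun a =>
    (((hmodel.smooth a a).contDiffAt (mem_interior_iff_mem_nhds.1 hθ₀)).differentiableAt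
      (by simp)).lineDifferentiableAt
  have h1 : (fun θ => ∑ a, ρ θ a a) =ᶠ[nhds θ₀] fun _ => (1 : ℂ) := by
    filter_upwards [mem_interior_iff_mem_nhds.1 hθ₀] with θ hθ
    exact (hmodel.density θ hθ).trace_eq_one
  have h2 : lineDeriv ℝ (fun θ => ∑ a, ρ θ a a) θ₀ (Pi.single i 1) =
      ∑ a, lineDeriv ℝ (fun θ => ρ θ a a) θ₀ (Pi.single i 1) :=
    deriv_fun_sum fun a _ => hd a
  rw [h1.lineDeriv_eq] at h2
  simpa [Matrix.trace, partialDeriv, lineDeriv] using h2.symm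

end

/-! ### The Cramér–Rao inequality -/

theorem star_dotProduct_conjTranspose_mul_diagonal_mul {m ι : Type*} [Fintype m] [DecidableEq m]
    [Fintype ι] (B : Matrix m ι ℂ) (w : m → ℝ) (u : ι → ℂ) :
    star u ⬝ᵥ ((Bᴴ * Matrix.diagonal (fun k => (w k : ℂ)) * B) *ᵥ u) =
      ((∑ k, w k * Complex.normSq ((B *ᵥ u) k) : ℝ) : ℂ) := by
  rw [← Matrix.mulVec_mulVec, ← Matrix.mulVec_mulVec, Matrix.dotProduct_mulVec,
    Matrix.vecMul_conjTranspose, star_star, dotProduct]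
  push_cast
  refine Finset.sum_congr rfl fun k _ => ?_
  rw [Matrix.mulVec_diagonal, Complex.normSq_eq_conj_mul_self, Pi.star_apply, Complex.star_def]
  ring

section

variable {X : Type*} [Fintype X] [DecidableEq X] {d : ℕ}

/-- Positive definiteness of the Fisher information with probabilities `p` and their derivatives
`C`, in the presence of an estimator with deviations `W`. -/
theorem posDef_of_mul_eq_one {p : X → ℝ} {C W : Matrix X (Fin d) ℝ} (hp : ∀ x, 0 ≤ p x)
    (hC : ∀ x, p x = 0 → ∀ i, C x i = 0) (hWC : Wᵀ * C = 1) :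
    (Cᵀ * Matrix.diagonal (fun x => (p x)⁻¹) * C).PosDef := by
  have hpsd : (Matrix.diagonal (fun x => (p x)⁻¹)).PosSemidef :=
    Matrix.PosSemidef.diagonal fun x => inv_nonneg.2 (hp x)
  have hps := hpsd.conjTranspose_mul_mul_same C
  rw [Matrix.conjTranspose_eq_transpose_of_trivial] at hps
  refine Matrix.PosDef.of_dotProduct_mulVec_pos hps.1 fun u hu => ?_
  have h1 : star u ⬝ᵥ ((Cᵀ * Matrix.diagonal (fun x => (p x)⁻¹) * C) *ᵥ u) =
      ∑ x, (p x)⁻¹ * (C *ᵥ u) x ^ 2 := by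
    rw [← Matrix.mulVec_mulVec, ← Matrix.mulVec_mulVec, Matrix.dotProduct_mulVec,
      Matrix.vecMul_transpose, star_trivial, dotProduct]
    refine Finset.sum_congr rfl fun k _ => ?_
    rw [Matrix.mulVec_diagonal]
    ring
  have hnn : ∀ x ∈ Finset.univ, 0 ≤ (p x)⁻¹ * (C *ᵥ u) x ^ 2 := fun x _ =>
    mul_nonneg (inv_nonneg.2 (hp x)) (sq_nonneg _)
  rw [h1]
  refine lt_of_le_of_ne (Finset.sum_nonneg hnn) fun h0 => hu ?_
  have h2 := (Finset.sum_eq_zero_iff_of_nonneg hnn).1 h0.symm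
  have h3 : C *ᵥ u = 0 := by
    ext x
    by_cases hx : p x = 0
    · simp [Matrix.mulVec, dotProduct, hC x hx]
    · simpa [hx] using h2 x (Finset.mem_univ x)
  rw [← Matrix.one_mulVec u, ← hWC, ← Matrix.mulVec_mulVec, h3, Matrix.mulVec_zero]

/-- The Cramér–Rao inequality: the difference is the covariance matrix of `W` minus the scores
multiplied by the inverse Fisher information. -/
theorem posSemidef_sub_inv_of_mul_eq_one {p : X → ℝ} {C W : Matrix X (Fin d) ℝ}
    (hp : ∀ x, 0 ≤ p x) (hC : ∀ x, p x = 0 → ∀ i, C x i = 0) (hWC : Wᵀ * C = 1) :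
    (Wᵀ * Matrix.diagonal p * W -
      (Cᵀ * Matrix.diagonal (fun x => (p x)⁻¹) * C)⁻¹).PosSemidef := by
  have hJ := posDef_of_mul_eq_one hp hC hWC
  set E := Matrix.diagonal (fun x => (p x)⁻¹) with hE
  set J := Cᵀ * E * C with hJdef
  have hJ1 : J⁻¹ * J = 1 := Matrix.nonsing_inv_mul _ ((Matrix.isUnit_iff_isUnit_det _).1 hJ.isUnit)
  have hJt : J⁻¹ᵀ = J⁻¹ := by simpa using hJ.inv.1.eq
  have hEt : Eᵀ = E := Matrix.diagonal_transpose _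
  have hCW : Cᵀ * W = 1 := by simpa using congrArg Matrix.transpose hWC
  have hpE : Matrix.diagonal p * (E * C) = C := by
    ext x i
    rw [Matrix.diagonal_mul, hE, Matrix.diagonal_mul]
    by_cases hx : p x = 0
    · simp [hC x hx]
    · field_simp
  have hEp : Cᵀ * E * Matrix.diagonal p = Cᵀ := by
    have := congrArg Matrix.transpose hpE
    simpa [hEt, Matrix.mul_assoc] using this
  have h := (Matrix.PosSemidef.diagonal (d := p) hp).conjTranspose_mul_mul_same (W - E * C * J⁻¹)
  rw [Matrix.conjTranspose_eq_transpose_of_trivial] at h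
  convert h using 1
  have e1 : (W - E * C * J⁻¹)ᵀ * Matrix.diagonal p = Wᵀ * Matrix.diagonal p - J⁻¹ * Cᵀ := by
    rw [Matrix.transpose_sub, Matrix.sub_mul, Matrix.transpose_mul, Matrix.transpose_mul, hJt, hEt,
      Matrix.mul_assoc J⁻¹, hEp]
  have e2 : Wᵀ * Matrix.diagonal p * (E * C * J⁻¹) = J⁻¹ := by
    rw [Matrix.mul_assoc Wᵀ, ← Matrix.mul_assoc (Matrix.diagonal p), hpE, ← Matrix.mul_assoc, hWC,
      Matrix.one_mul]
  have e3 : J⁻¹ * Cᵀ * W = J⁻¹ := by rw [Matrix.mul_assoc, hCW, Matrix.mul_one]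
  have e4 : J⁻¹ * Cᵀ * (E * C * J⁻¹) = J⁻¹ := by
    have : J⁻¹ * Cᵀ * (E * C * J⁻¹) = J⁻¹ * J * J⁻¹ := by
      rw [hJdef]; simp only [Matrix.mul_assoc]
    rw [this, hJ1, Matrix.one_mul]
  rw [e1, Matrix.sub_mul, Matrix.mul_sub, Matrix.mul_sub, e2, e3, e4]
  abel

end

/-- The derivatives `Tr ∂ᵢρ Mₓ` of the outcome probabilities, one row for each outcome `x`. -/
noncomputable def scoreMatrix {n X : Type*} [Fintype n] {d : ℕ}
    (ρ : (Fin d → ℝ) → Matrix n n ℂ) (θ₀ : Fin d → ℝ) (M : X → Matrix n n ℂ) :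
    Matrix X (Fin d) ℝ :=
  Matrix.of fun x i => trPair (partialDeriv ρ θ₀ i) (M x)

section

variable {n X : Type*} [Fintype n] [Fintype X] {d : ℕ}
  {Θ : Set (Fin d → ℝ)} {ρ : (Fin d → ℝ) → Matrix n n ℂ} {θ₀ : Fin d → ℝ}
  {M : X → Matrix n n ℂ} {θhat : X → Fin d → ℝ}

theorem classicalFisher_eq [DecidableEq X] (ρ : (Fin d → ℝ) → Matrix n n ℂ) (θ₀ : Fin d → ℝ)
    (M : X → Matrix n n ℂ) : classicalFisher ρ θ₀ M = (scoreMatrix ρ θ₀ M)ᵀ *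
      Matrix.diagonal (fun x => (trPair (ρ θ₀) (M x))⁻¹) * scoreMatrix ρ θ₀ M := by
  ext i j
  rw [Matrix.mul_apply]
  refine Finset.sum_congr rfl fun x _ => ?_
  rw [Matrix.mul_diagonal]
  simp only [scoreMatrix, Matrix.transpose_apply, Matrix.of_apply]
  ring

theorem covMatrix_eq [DecidableEq X] (ρ : (Fin d → ℝ) → Matrix n n ℂ) (θ₀ : Fin d → ℝ)
    (M : X → Matrix n n ℂ) (θhat : X → Fin d → ℝ) :
    covMatrix ρ θ₀ M θhat = (Matrix.of fun x i => θhat x i - θ₀ i)ᵀ *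
      Matrix.diagonal (fun x => trPair (ρ θ₀) (M x)) *
      (Matrix.of fun x i => θhat x i - θ₀ i) := by
  ext i j
  rw [Matrix.mul_apply]
  refine Finset.sum_congr rfl fun x _ => ?_
  rw [Matrix.mul_diagonal]
  simp only [Matrix.transpose_apply, Matrix.of_apply]
  ring

variable [DecidableEq n]

/-- An outcome of probability zero has `Mₓ = 0`; omitting it loses nothing. -/
theorem scoreMatrix_eq_zero (hρ : (ρ θ₀).PosDef) (hM : IsPOVM M) (x : X)
    (hx : trPair (ρ θ₀) (M x) = 0) (i : Fin d) : scoreMatrix ρ θ₀ M x i = 0 := by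
  have h : (ρ θ₀ * M x).trace = 0 := by
    rw [← ofReal_trPair hρ.1 (hM.posSemidef x).1, hx, Complex.ofReal_zero]
  simp [scoreMatrix, trPair, eq_zero_of_trace_mul_eq_zero hρ (hM.posSemidef x) h]

/-- Local unbiasedness. Subtracting `θ₀` is harmless because `∑ₓ Tr ∂ⱼρ Mₓ = Tr ∂ⱼρ = 0`. -/
theorem transpose_mul_scoreMatrix (hmodel : IsSmoothModel Θ ρ) (hθ₀ : θ₀ ∈ interior Θ)
    (hest : IsLocallyUnbiased ρ θ₀ M θhat) :
    (Matrix.of fun x i => θhat x i - θ₀ i)ᵀ * scoreMatrix ρ θ₀ M = 1 := by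
  ext i j
  have h0 : ∑ x, trPair (partialDeriv ρ θ₀ j) (M x) = 0 := by
    simp only [trPair]
    rw [← Complex.re_sum, ← Matrix.trace_sum, ← Matrix.mul_sum, hest.povm.sum_eq_one,
      Matrix.mul_one, hmodel.trace_partialDeriv hθ₀, Complex.zero_re]
  simp only [Matrix.mul_apply, Matrix.transpose_apply, Matrix.of_apply, scoreMatrix, sub_mul,
    Finset.sum_sub_distrib, hest.deriv_mean i j, ← Finset.mul_sum, h0, mul_zero, sub_zero,
    Matrix.one_apply]

theorem posDef_classicalFisher (hmodel : IsSmoothModel Θ ρ) (hθ₀ : θ₀ ∈ interior Θ)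
    (hρ : (ρ θ₀).PosDef) (hest : IsLocallyUnbiased ρ θ₀ M θhat) :
    (classicalFisher ρ θ₀ M).PosDef := by
  classical
  rw [classicalFisher_eq]
  exact posDef_of_mul_eq_one (fun x => trPair_nonneg hρ.posSemidef (hest.povm.posSemidef x))
    (scoreMatrix_eq_zero hρ hest.povm) (transpose_mul_scoreMatrix hmodel hθ₀ hest)

theorem trace_mul_inv_classicalFisher_le (hmodel : IsSmoothModel Θ ρ) (hθ₀ : θ₀ ∈ interior Θ)
    (hρ : (ρ θ₀).PosDef) (hest : IsLocallyUnbiased ρ θ₀ M θhat)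
    {G : Matrix (Fin d) (Fin d) ℝ} (hG : G.PosSemidef) :
    (G * (classicalFisher ρ θ₀ M)⁻¹).trace ≤ (G * covMatrix ρ θ₀ M θhat).trace := by
  classical
  have h := posSemidef_sub_inv_of_mul_eq_one
    (fun x => trPair_nonneg hρ.posSemidef (hest.povm.posSemidef x))
    (scoreMatrix_eq_zero hρ hest.povm) (transpose_mul_scoreMatrix hmodel hθ₀ hest)
  rw [← classicalFisher_eq, ← covMatrix_eq] at h
  have := trace_mul_nonneg hG h
  rwa [Matrix.mul_sub, Matrix.trace_sub, sub_nonneg] at this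

/-! ### Classical and quantum Fisher information -/

theorem scoreMatrix_mulVec (hmodel : IsSmoothModel Θ ρ) (hθ₀ : θ₀ ∈ interior Θ)
    (hM : IsPOVM M) (u : Fin d → ℂ) (x : X) :
    ((scoreMatrix ρ θ₀ M).map Complex.ofReal *ᵥ u) x =
      ((∑ i, u i • partialDeriv ρ θ₀ i) * M x).trace := by
  rw [Matrix.sum_mul, Matrix.trace_sum, Matrix.mulVec, dotProduct]
  refine Finset.sum_congr rfl fun i _ => ?_
  rw [Matrix.smul_mul, Matrix.trace_smul, ← ofReal_trPair
    (hmodel.isHermitian_partialDeriv hθ₀ i) (hM.posSemidef x).1, smul_eq_mul, mul_comm]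
  rfl

/-- Local unbiasedness makes the derivatives `∂ᵢρ` linearly independent over `ℂ`. -/
theorem entryMatrix_mulVec_injective (hmodel : IsSmoothModel Θ ρ) (hθ₀ : θ₀ ∈ interior Θ)
    (hest : IsLocallyUnbiased ρ θ₀ M θhat) {U : Matrix n n ℂ} (hU' : U * Uᴴ = 1) :
    Function.Injective (entryMatrix U (partialDeriv ρ θ₀)).mulVec := by
  have key : ∀ u, entryMatrix U (partialDeriv ρ θ₀) *ᵥ u = 0 → u = 0 := by
    intro u hu
    have h1 : Uᴴ * (∑ i, u i • partialDeriv ρ θ₀ i) * U = 0 := by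
      ext a b
      simpa [entryMatrix_mulVec] using congrFun hu (a, b)
    have h2 : ∑ i, u i • partialDeriv ρ θ₀ i = 0 := by
      calc ∑ i, u i • partialDeriv ρ θ₀ i
          = (U * Uᴴ) * (∑ i, u i • partialDeriv ρ θ₀ i) * (U * Uᴴ) := by
            rw [hU', Matrix.one_mul, Matrix.mul_one]
        _ = U * (Uᴴ * (∑ i, u i • partialDeriv ρ θ₀ i) * U) * Uᴴ := by
            simp only [Matrix.mul_assoc]
        _ = 0 := by rw [h1, Matrix.mul_zero, Matrix.zero_mul]
    have h3 : (scoreMatrix ρ θ₀ M).map Complex.ofReal *ᵥ u = 0 := by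
      ext x
      rw [scoreMatrix_mulVec hmodel hθ₀ hest.povm, h2]
      simp
    have h4 := congrArg (fun Z : Matrix (Fin d) (Fin d) ℝ => Z.map Complex.ofReal)
      (transpose_mul_scoreMatrix hmodel hθ₀ hest)
    have h5 : ((Matrix.of fun x i => θhat x i - θ₀ i)ᵀ).map Complex.ofReal *
        (scoreMatrix ρ θ₀ M).map Complex.ofReal = 1 := by
      rw [← Matrix.map_one Complex.ofReal Complex.ofReal_zero Complex.ofReal_one, ← h4]
      exact (Matrix.map_mul (f := Complex.ofRealHom)).symm
    rw [← Matrix.one_mulVec u, ← h5, ← Matrix.mulVec_mulVec, h3, Matrix.mulVec_zero]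
  intro u v huv
  have := key (u - v) (by rw [Matrix.mulVec_sub]; exact sub_eq_zero.2 huv)
  exact sub_eq_zero.1 this

theorem posDef_fisherInfo (hmodel : IsSmoothModel Θ ρ) (hθ₀ : θ₀ ∈ interior Θ)
    (hρ : (ρ θ₀).PosDef) (hest : IsLocallyUnbiased ρ θ₀ M θhat) {P : ℝ → ℝ}
    (hP : ∀ x, 0 < x → 0 < P x) : (fisherInfo ρ θ₀ P).PosDef := by
  obtain ⟨U, p, hU, hU', hσ, hp⟩ := exists_diagonalization hρ
  rw [fisherInfo_eq hU hU' hσ hp hP]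
  refine (Matrix.PosDef.diagonal fun ab => ?_).conjTranspose_mul_mul_same
    (entryMatrix_mulVec_injective hmodel hθ₀ hest hU')
  exact Complex.zero_lt_real.2 (inv_pos.2 (mul_pos (hp _) (hP _ (div_pos (hp _) (hp _)))))

end

theorem diagSuper_linear {n : Type*} [Fintype n] {U : Matrix n n ℂ} (r s : ℝ)
    (w w' : n → n → ℝ) (Y : Matrix n n ℂ) :
    diagSuper U (fun a b => r * w a b + s * w' a b) Y =
      (r : ℂ) • diagSuper U w Y + (s : ℂ) • diagSuper U w' Y := by
  simp only [diagSuper_apply]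
  rw [← Matrix.smul_mul, ← Matrix.mul_smul, ← Matrix.smul_mul, ← Matrix.mul_smul,
    ← Matrix.add_mul, ← Matrix.mul_add]
  congr 2
  ext a b
  simp
  ring

section

variable {n X : Type*} [Fintype n] [DecidableEq n] [Fintype X]

theorem IsPOVM.conjTranspose_sum_smul {M : X → Matrix n n ℂ} (hM : IsPOVM M) (c : X → ℂ) :
    (∑ x, c x • M x)ᴴ = ∑ x, star (c x) • M x := by
  rw [Matrix.conjTranspose_sum]
  refine Finset.sum_congr rfl fun x _ => ?_
  rw [Matrix.conjTranspose_smul, (hM.posSemidef x).1.eq]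

/-- Schwarz-type inequality: `∑ |cₓ|² Mₓ - B* B = ∑ (cₓ - B)* Mₓ (cₓ - B)` for `B = ∑ cₓ Mₓ`. -/
theorem posSemidef_sum_normSq_smul_sub {M : X → Matrix n n ℂ} (hM : IsPOVM M) (c : X → ℂ) :
    (∑ x, ((Complex.normSq (c x) : ℝ) : ℂ) • M x -
      (∑ x, c x • M x)ᴴ * ∑ x, c x • M x).PosSemidef := by
  set B := ∑ x, c x • M x with hB
  have hBH : Bᴴ = ∑ x, star (c x) • M x := hM.conjTranspose_sum_smul c
  have h : (∑ x, (c x • (1 : Matrix n n ℂ) - B)ᴴ * M x * (c x • 1 - B)).PosSemidef :=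
    Matrix.posSemidef_sum _ fun x _ => (hM.posSemidef x).conjTranspose_mul_mul_same _
  convert h using 1
  have h1 : ∀ x, (c x • (1 : Matrix n n ℂ) - B)ᴴ * M x * (c x • 1 - B) =
      ((Complex.normSq (c x) : ℝ) : ℂ) • M x - (star (c x) • M x) * B - Bᴴ * (c x • M x) +
        Bᴴ * M x * B := by
    intro x
    rw [Complex.normSq_eq_conj_mul_self, ← Complex.star_def]
    simp only [Matrix.conjTranspose_sub, Matrix.conjTranspose_smul, Matrix.conjTranspose_one,
      Matrix.sub_mul, Matrix.mul_sub, Matrix.smul_mul, Matrix.mul_smul, Matrix.one_mul,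
      Matrix.mul_one, smul_smul, smul_sub]
    rw [mul_comm (c x)]
    abel
  simp only [h1, Finset.sum_add_distrib, Finset.sum_sub_distrib, ← Matrix.sum_mul,
    ← Matrix.mul_sum, ← hBH, ← hB, hM.sum_eq_one, Matrix.mul_one]
  abel

theorem two_mul_re_sub_le {w : ℝ} (hw : 0 < w) (x b : ℂ) :
    2 * (star b * x).re - w * Complex.normSq b ≤ w⁻¹ * Complex.normSq x := by
  have h := mul_nonneg (inv_nonneg.2 hw.le) (Complex.normSq_nonneg (x - (w : ℂ) * b))
  have h2 : w⁻¹ * Complex.normSq (x - (w : ℂ) * b) =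
      w⁻¹ * Complex.normSq x - (2 * (star b * x).re - w * Complex.normSq b) := by
    simp only [Complex.normSq_apply, Complex.sub_re, Complex.sub_im, Complex.mul_re,
      Complex.mul_im, Complex.ofReal_re, Complex.ofReal_im, Complex.star_def, Complex.conj_re,
      Complex.conj_im]
    field_simp
    ring
  linarith

/-- The metric `K^{(β)}` dominates the classical Fisher metric of every measurement. Testing the
variational inequality `⟨X, S⁻¹X⟩ ≥ 2 Re ⟨B, X⟩ - ⟨B, SB⟩`, `S = r L + s R`, with
`B = ∑ cₓ Mₓ`, `cₓ = Tr X Mₓ / Tr σ Mₓ`, gives the claim. -/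
theorem sum_normSq_trace_div_le {M : X → Matrix n n ℂ} (hM : IsPOVM M) {σ U : Matrix n n ℂ}
    {p : n → ℝ} (hσ : σ.PosDef) (hU' : U * Uᴴ = 1)
    (hσU : σ = U * Matrix.diagonal (fun a => (p a : ℂ)) * Uᴴ) {r s : ℝ} (hr : 0 ≤ r) (hs : 0 ≤ s)
    (hrs : r + s = 1) (hw : ∀ a b, 0 < r * p a + s * p b) (Y : Matrix n n ℂ) :
    ∑ x, (trPair σ (M x))⁻¹ * Complex.normSq (Y * M x).trace ≤
      ∑ a, ∑ b, (r * p a + s * p b)⁻¹ * Complex.normSq ((Uᴴ * Y * U) a b) := by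
  set q : X → ℝ := fun x => trPair σ (M x) with hq
  set F := ∑ x, (q x)⁻¹ * Complex.normSq (Y * M x).trace with hF
  set c : X → ℂ := fun x => ((q x)⁻¹ : ℝ) * (Y * M x).trace with hc
  set B := ∑ x, c x • M x with hB
  have hBH : Bᴴ = ∑ x, star (c x) • M x := hM.conjTranspose_sum_smul c
  -- where `q x = 0`, the junk value `(q x)⁻¹ = 0` makes both sides vanish
  have hcF : ∑ x, Complex.normSq (c x) * q x = F := by
    refine Finset.sum_congr rfl fun x _ => ?_
    rw [hc]
    simp only [Complex.normSq_mul, Complex.normSq_ofReal]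
    by_cases hx : q x = 0
    · simp [hx]
    · field_simp
  have hBY : (Bᴴ * Y).trace.re = F := by
    rw [hBH, Matrix.sum_mul, Matrix.trace_sum, Complex.re_sum]
    refine Finset.sum_congr rfl fun x _ => ?_
    rw [Matrix.smul_mul, Matrix.trace_smul, Matrix.trace_mul_comm, smul_eq_mul, hc]
    simp only [star_mul', Complex.star_def, Complex.conj_ofReal]
    rw [mul_assoc, ← Complex.normSq_eq_conj_mul_self, ← Complex.ofReal_mul, Complex.ofReal_re]
  have htr : ∀ Z : Matrix n n ℂ, (∑ x, ((Complex.normSq (c x) : ℝ) : ℂ) • M x - Z).PosSemidef →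
      (σ * Z).trace.re ≤ F := by
    intro Z hZ
    have h := trPair_nonneg hσ.posSemidef hZ
    rw [trPair, Matrix.mul_sub, Matrix.trace_sub, Complex.sub_re, Matrix.mul_sum, Matrix.trace_sum,
      Complex.re_sum] at h
    have h2 : ∑ x, (σ * ((Complex.normSq (c x) : ℝ) : ℂ) • M x).trace.re = F := by
      rw [← hcF]
      refine Finset.sum_congr rfl fun x _ => ?_
      rw [Matrix.mul_smul, Matrix.trace_smul, smul_eq_mul, Complex.re_ofReal_mul]
      rfl
    linarith
  have hB1 : (σ * (Bᴴ * B)).trace.re ≤ F := htr _ (posSemidef_sum_normSq_smul_sub hM c)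
  have hB2 : (σ * (B * Bᴴ)).trace.re ≤ F := by
    have h := posSemidef_sum_normSq_smul_sub hM (fun x => star (c x))
    rw [← hBH, Matrix.conjTranspose_conjTranspose] at h
    simp only [Complex.star_def, Complex.normSq_conj] at h
    exact htr _ h
  -- `⟨B, SB⟩ ≤ F`
  have hBB : ∑ a, ∑ b, (r * p a + s * p b) * Complex.normSq ((Uᴴ * B * U) a b) ≤ F := by
    have h1 : (Bᴴ * diagSuper U (fun a b => r * p a + s * p b) B).trace.re =
        r * (σ * (B * Bᴴ)).trace.re + s * (σ * (Bᴴ * B)).trace.re := by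
      have e := diagSuper_linear (U := U) r s (fun a _ => p a) (fun _ b => p b) B
      rw [e, ← superL_eq_diagSuper hU' hσU, ← superR_eq_diagSuper hU' hσU, superL, superR,
        LinearMap.mulLeft_apply, LinearMap.mulRight_apply, Matrix.mul_add, Matrix.trace_add,
        Matrix.mul_smul, Matrix.mul_smul, Matrix.trace_smul, Matrix.trace_smul, Complex.add_re,
        smul_eq_mul, smul_eq_mul, Complex.re_ofReal_mul, Complex.re_ofReal_mul]
      congr 3
      · rw [Matrix.trace_mul_comm, Matrix.mul_assoc]
      · rw [← Matrix.mul_assoc, Matrix.trace_mul_comm]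
    have h2 : (Bᴴ * diagSuper U (fun a b => r * p a + s * p b) B).trace.re =
        ∑ a, ∑ b, (r * p a + s * p b) * Complex.normSq ((Uᴴ * B * U) a b) := by
      rw [trace_conjTranspose_mul_diagSuper, Complex.re_sum]
      refine Finset.sum_congr rfl fun a _ => ?_
      rw [Complex.re_sum]
      refine Finset.sum_congr rfl fun b _ => ?_
      rw [mul_left_comm, Complex.re_ofReal_mul, Complex.star_def,
        ← Complex.normSq_eq_conj_mul_self, Complex.ofReal_re]
    rw [← h2, h1]
    calc r * (σ * (B * Bᴴ)).trace.re + s * (σ * (Bᴴ * B)).trace.re ≤ r * F + s * F := by gcongr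
      _ = F := by rw [← add_mul, hrs, one_mul]
  have hBY' : ∑ a, ∑ b, (star ((Uᴴ * B * U) a b) * (Uᴴ * Y * U) a b).re = F := by
    rw [← hBY]
    have := trace_conjTranspose_mul_diagSuper U (fun _ _ => 1) B Y
    rw [diagSuper_one hU', Module.End.one_apply] at this
    rw [this, Complex.re_sum]
    refine Finset.sum_congr rfl fun a _ => ?_
    rw [Complex.re_sum]
    simp
  have hsum : ∑ a, ∑ b, (2 * (star ((Uᴴ * B * U) a b) * (Uᴴ * Y * U) a b).re -
      (r * p a + s * p b) * Complex.normSq ((Uᴴ * B * U) a b)) ≤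
      ∑ a, ∑ b, (r * p a + s * p b)⁻¹ * Complex.normSq ((Uᴴ * Y * U) a b) :=
    Finset.sum_le_sum fun a _ => Finset.sum_le_sum fun b _ => two_mul_re_sub_le (hw a b) _ _
  simp only [Finset.sum_sub_distrib, ← Finset.mul_sum, hBY'] at hsum
  linarith

end

/-! ### Comparison of the bounds -/

section

variable {n X : Type*} [Fintype n] [DecidableEq n] [Fintype X] {d : ℕ}
  {Θ : Set (Fin d → ℝ)} {ρ : (Fin d → ℝ) → Matrix n n ℂ} {θ₀ : Fin d → ℝ}
  {M : X → Matrix n n ℂ} {θhat : X → Fin d → ℝ} {G : Matrix (Fin d) (Fin d) ℝ}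

/-- Only the values of `P` and `Q` on the spectrum `{p_a / p_b}` of `L R⁻¹` matter. -/
theorem boundP_le_mul_of_ratio (hmodel : IsSmoothModel Θ ρ) (hθ₀ : θ₀ ∈ interior Θ)
    (hρ : (ρ θ₀).PosDef) (hest : IsLocallyUnbiased ρ θ₀ M θhat) (hG : G.PosSemidef)
    {U : Matrix n n ℂ} (hU : Uᴴ * U = 1) (hU' : U * Uᴴ = 1) {p : n → ℝ}
    (hσ : ρ θ₀ = U * Matrix.diagonal (fun a => (p a : ℂ)) * Uᴴ) (hp : ∀ a, 0 < p a)
    {P Q : ℝ → ℝ} (hP : ∀ x, 0 < x → 0 < P x) (hQ : ∀ x, 0 < x → 0 < Q x) {t : ℝ} (ht : 0 < t)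
    (hPQ : ∀ a b, P (p a / p b) ≤ t * Q (p a / p b)) :
    boundP ρ θ₀ G P ≤ t * boundP ρ θ₀ G Q := by
  refine weightedBound_le_mul hG (posDef_fisherInfo hmodel hθ₀ hρ hest hP)
    (posDef_fisherInfo hmodel hθ₀ hρ hest hQ) ht ?_
  rw [fisherInfo_eq hU hU' hσ hp hP, fisherInfo_eq hU hU' hσ hp hQ, ← Matrix.smul_mul,
    ← Matrix.mul_smul, ← Matrix.sub_mul, ← Matrix.mul_sub, ← Matrix.diagonal_smul,
    Matrix.diagonal_sub]
  refine (Matrix.PosSemidef.diagonal fun ab => ?_).conjTranspose_mul_mul_same _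
  have hx : 0 < p ab.1 / p ab.2 := div_pos (hp _) (hp _)
  have h1 : (p ab.2 * Q (p ab.1 / p ab.2))⁻¹ ≤ t * (p ab.2 * P (p ab.1 / p ab.2))⁻¹ := by
    rw [← div_eq_mul_inv, le_div_iff₀ (mul_pos (hp _) (hP _ hx)),
      inv_mul_le_iff₀ (mul_pos (hp _) (hQ _ hx))]
    nlinarith [mul_le_mul_of_nonneg_left (hPQ ab.1 ab.2) (hp ab.2).le]
  have h2 : (0 : ℂ) ≤ ((t * (p ab.2 * P (p ab.1 / p ab.2))⁻¹ -
      (p ab.2 * Q (p ab.1 / p ab.2))⁻¹ : ℝ) : ℂ) := Complex.zero_le_real.2 (sub_nonneg.2 h1)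
  rw [Complex.ofReal_sub, Complex.ofReal_mul] at h2
  exact h2

theorem boundP_le_of_le (hmodel : IsSmoothModel Θ ρ) (hθ₀ : θ₀ ∈ interior Θ)
    (hρ : (ρ θ₀).PosDef) (hest : IsLocallyUnbiased ρ θ₀ M θhat) (hG : G.PosSemidef)
    {P Q : ℝ → ℝ} (hP : ∀ x, 0 < x → 0 < P x) (hPQ : ∀ x, 0 < x → P x ≤ Q x) :
    boundP ρ θ₀ G P ≤ boundP ρ θ₀ G Q := by
  obtain ⟨U, p, hU, hU', hσ, hp⟩ := exists_diagonalization hρ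
  simpa using boundP_le_mul_of_ratio hmodel hθ₀ hρ hest hG hU hU' hσ hp hP
    (fun x hx => (hP x hx).trans_le (hPQ x hx)) one_pos
    (fun a b => by simpa using hPQ _ (div_pos (hp a) (hp b)))

theorem weightedBound_map_ofReal (G J : Matrix (Fin d) (Fin d) ℝ) (hJ : J.PosDef) :
    weightedBound G (J.map Complex.ofReal) = (G * J⁻¹).trace := by
  have hinv : (J.map Complex.ofReal)⁻¹ = J⁻¹.map Complex.ofReal := by
    refine Matrix.inv_eq_left_inv ?_
    have h : J⁻¹ * J = 1 :=
      Matrix.nonsing_inv_mul _ ((Matrix.isUnit_iff_isUnit_det _).1 hJ.isUnit)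
    rw [← Matrix.map_one Complex.ofReal Complex.ofReal_zero Complex.ofReal_one, ← h]
    exact (Matrix.map_mul (f := Complex.ofRealHom)).symm
  have him : (J⁻¹.map Complex.ofReal).map Complex.im = 0 := by
    ext i j
    simp
  have htr : (G.map Complex.ofReal * J⁻¹.map Complex.ofReal).trace.re = (G * J⁻¹).trace := by
    simp [Matrix.trace, Matrix.mul_apply]
  have h0 : cfc Real.sqrt (0 : Matrix (Fin d) (Fin d) ℝ) = 0 := by
    rw [cfc_apply_zero]
    simp
  rw [weightedBound, hinv, him, htr, trAbs]
  simp [h0]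

theorem posSemidef_fisherInfo_betaFun_sub (hmodel : IsSmoothModel Θ ρ) (hθ₀ : θ₀ ∈ interior Θ)
    (hρ : (ρ θ₀).PosDef) (hM : IsPOVM M) {β : ℝ} (hβ : β ∈ Set.Icc (-1 : ℝ) 1) :
    (fisherInfo ρ θ₀ (betaFun β) - (classicalFisher ρ θ₀ M).map Complex.ofReal).PosSemidef := by
  classical
  obtain ⟨U, p, hU, hU', hσ, hp⟩ := exists_diagonalization hρ
  have hw : ∀ a b, p b * betaFun β (p a / p b) = (1 + β) / 2 * p a + (1 - β) / 2 * p b := by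
    intro a b
    have := (hp b).ne'
    rw [betaFun]
    field_simp
  have hw0 : ∀ a b, 0 < (1 + β) / 2 * p a + (1 - β) / 2 * p b := fun a b => by
    rw [← hw]
    exact mul_pos (hp b) (betaFun_pos hβ (div_pos (hp a) (hp b)))
  have hJ : (classicalFisher ρ θ₀ M).map Complex.ofReal =
      ((scoreMatrix ρ θ₀ M).map Complex.ofReal)ᴴ *
        Matrix.diagonal (fun x => (((trPair (ρ θ₀) (M x))⁻¹ : ℝ) : ℂ)) *
        (scoreMatrix ρ θ₀ M).map Complex.ofReal := by
    rw [classicalFisher_eq]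
    ext i j
    rw [Matrix.map_apply, Matrix.mul_apply, Matrix.mul_apply, Complex.ofReal_sum]
    refine Finset.sum_congr rfl fun x _ => ?_
    rw [Matrix.mul_diagonal, Matrix.mul_diagonal]
    simp
  have hF := fisherInfo_eq hU hU' hσ hp (P := betaFun β) (fun x hx => betaFun_pos hβ hx)
  rw [hJ, hF]
  refine Matrix.PosSemidef.of_dotProduct_mulVec_nonneg ?_ fun u => ?_
  · refine Matrix.IsHermitian.sub ?_ ?_ <;>
      exact Matrix.isHermitian_conjTranspose_mul_mul _
        (Matrix.isHermitian_diagonal_of_self_adjoint _ (by ext; simp))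
  · rw [Matrix.sub_mulVec, dotProduct_sub, star_dotProduct_conjTranspose_mul_diagonal_mul,
      star_dotProduct_conjTranspose_mul_diagonal_mul, ← Complex.ofReal_sub]
    refine Complex.zero_le_real.2 (sub_nonneg.2 ?_)
    simp only [scoreMatrix_mulVec hmodel hθ₀ hM, entryMatrix_mulVec, Fintype.sum_prod_type, hw]
    rcases hβ with ⟨h1, h2⟩
    exact sum_normSq_trace_div_le hM hρ hU' hσ (by linarith) (by linarith) (by ring) hw0 _

theorem boundBeta_le_trace (hmodel : IsSmoothModel Θ ρ) (hθ₀ : θ₀ ∈ interior Θ)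
    (hρ : (ρ θ₀).PosDef) (hest : IsLocallyUnbiased ρ θ₀ M θhat) (hG : G.PosSemidef) {β : ℝ}
    (hβ : β ∈ Set.Icc (-1 : ℝ) 1) :
    boundBeta ρ θ₀ G β ≤ (G * (classicalFisher ρ θ₀ M)⁻¹).trace := by
  classical
  have hJ := posDef_classicalFisher hmodel hθ₀ hρ hest
  have hJc : ((classicalFisher ρ θ₀ M).map Complex.ofReal).PosDef := by
    obtain ⟨C, hC⟩ := exists_eq_conjTranspose_mul_self hJ.posSemidef
    have h1 : (classicalFisher ρ θ₀ M).map Complex.ofReal =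
        (C.map Complex.ofReal)ᴴ * C.map Complex.ofReal := by
      conv_lhs => rw [hC]
      ext i j
      simp [Matrix.mul_apply]
    have hps : ((classicalFisher ρ θ₀ M).map Complex.ofReal).PosSemidef := by
      rw [h1]
      exact Matrix.posSemidef_conjTranspose_mul_self _
    refine hps.posDef_iff_isUnit.2 ((Matrix.isUnit_iff_isUnit_det _).2 ?_)
    have h2 : ((classicalFisher ρ θ₀ M).map Complex.ofReal).det =
        (((classicalFisher ρ θ₀ M).det : ℝ) : ℂ) :=
      (RingHom.map_det Complex.ofRealHom (classicalFisher ρ θ₀ M)).symm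
    rw [h2, isUnit_iff_ne_zero]
    exact_mod_cast hJ.det_pos.ne'
  have h := weightedBound_le_mul hG
    (posDef_fisherInfo hmodel hθ₀ hρ hest fun x hx => betaFun_pos hβ hx) hJc one_pos
    (by simpa using posSemidef_fisherInfo_betaFun_sub hmodel hθ₀ hρ hest.povm hβ)
  rwa [one_mul, weightedBound_map_ofReal G _ hJ] at h

/-- On Hermitian matrices, swapping the arguments of the metric exchanges `L` and `R`. -/
theorem fisherInfo_betaFun_neg (hmodel : IsSmoothModel Θ ρ) (hθ₀ : θ₀ ∈ interior Θ)
    (hρ : (ρ θ₀).PosDef) {β : ℝ} (hβ : β ∈ Set.Icc (-1 : ℝ) 1) :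
    fisherInfo ρ θ₀ (betaFun (-β)) = (fisherInfo ρ θ₀ (betaFun β))ᵀ := by
  obtain ⟨U, p, hU, hU', hσ, hp⟩ := exists_diagonalization hρ
  have hβ' : -β ∈ Set.Icc (-1 : ℝ) 1 := ⟨by linarith [hβ.2], by linarith [hβ.1]⟩
  have hw : ∀ a b, p b * betaFun (-β) (p a / p b) = p a * betaFun β (p b / p a) := by
    intro a b
    have := (hp a).ne'
    have := (hp b).ne'
    simp only [betaFun]
    field_simp
    ring
  have hD : ∀ i a b, star ((Uᴴ * partialDeriv ρ θ₀ i * U) a b) =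
      (Uᴴ * partialDeriv ρ θ₀ i * U) b a := fun i a b =>
    (Matrix.isHermitian_conjTranspose_mul_mul U
      (hmodel.isHermitian_partialDeriv hθ₀ i)).apply b a
  ext i j
  rw [Matrix.transpose_apply, fisherInfo, fisherInfo, Matrix.of_apply, Matrix.of_apply,
    monotoneMetric, monotoneMetric,
    petzOp_eq_diagSuper hU hU' hσ hp (fun x hx => betaFun_pos hβ hx),
    petzOp_eq_diagSuper hU hU' hσ hp (fun x hx => betaFun_pos hβ' hx),
    trace_conjTranspose_mul_diagSuper, trace_conjTranspose_mul_diagSuper, Finset.sum_comm]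
  refine Finset.sum_congr rfl fun b _ => Finset.sum_congr rfl fun a _ => ?_
  rw [hw, hD, hD]
  ring

theorem weightedBound_transpose (hG : G.PosSemidef) {J : Matrix (Fin d) (Fin d) ℂ}
    (hJ : J.PosDef) : weightedBound G Jᵀ = weightedBound G J := by
  rw [weightedBound_eq_holevoValue hG, weightedBound_eq_holevoValue hG]
  set S := (cfc Real.sqrt G).map Complex.ofReal with hS
  have hSt : Sᵀ = S := by
    ext i j
    simpa [hS] using congrArg Complex.ofReal ((isHermitian_cfc Real.sqrt G).apply i j)
  have hSh : Sᴴ = S := by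
    ext i j
    simpa [hS] using congrArg Complex.ofReal ((isHermitian_cfc Real.sqrt G).apply i j)
  have h1 : S * (Jᵀ)⁻¹ * S = (S * J⁻¹ * S)ᵀ := by
    rw [Matrix.transpose_mul, Matrix.transpose_mul, hSt, ← Matrix.transpose_nonsing_inv,
      Matrix.mul_assoc]
  have hH : (S * J⁻¹ * S).IsHermitian := by
    have := Matrix.isHermitian_mul_mul_conjTranspose S hJ.inv.1
    rwa [hSh] at this
  rw [h1, holevoValue, holevoValue, Matrix.trace_transpose, Matrix.transpose_map,
    transpose_map_im hH, trAbs, trAbs, Matrix.transpose_neg, neg_mul_neg]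

/-- `J^{(-β)}` and `J^{(β)}` are transposes of each other, so they give the same bound. -/
theorem boundBeta_abs (hmodel : IsSmoothModel Θ ρ) (hθ₀ : θ₀ ∈ interior Θ)
    (hρ : (ρ θ₀).PosDef) (hest : IsLocallyUnbiased ρ θ₀ M θhat) (hG : G.PosSemidef) {β : ℝ}
    (hβ : β ∈ Set.Icc (-1 : ℝ) 1) : boundBeta ρ θ₀ G |β| = boundBeta ρ θ₀ G β := by
  rcases abs_choice β with h | h
  · rw [h]
  · rw [h, boundBeta, boundBeta, boundP, boundP, fisherInfo_betaFun_neg hmodel hθ₀ hρ hβ]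
    exact weightedBound_transpose hG
      (posDef_fisherInfo hmodel hθ₀ hρ hest fun x hx => betaFun_pos hβ hx)

/-- Since the spectrum of `L R⁻¹` is bounded away from `0`, `P^{(β)}` is at most
`(1 + κ |β - γ|) P^{(γ)}` on it. -/
theorem exists_boundBeta_le_mul (hmodel : IsSmoothModel Θ ρ) (hθ₀ : θ₀ ∈ interior Θ)
    (hρ : (ρ θ₀).PosDef) (hest : IsLocallyUnbiased ρ θ₀ M θhat) (hG : G.PosSemidef) :
    ∃ κ : ℝ, 0 ≤ κ ∧ ∀ β ∈ Set.Icc (0 : ℝ) 1, ∀ γ ∈ Set.Icc (0 : ℝ) 1,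
      boundBeta ρ θ₀ G β ≤ (1 + κ * |β - γ|) * boundBeta ρ θ₀ G γ := by
  obtain ⟨U, p, hU, hU', hσ, hp⟩ := exists_diagonalization hρ
  -- `κ` dominates every `1 + p b / p a`, that is, every `(x + 1) / x` for `x = p a / p b`
  refine ⟨1 + ∑ a, ∑ b, p b / p a, ?_, fun β hβ γ hγ => ?_⟩
  · have : 0 ≤ ∑ a, ∑ b, p b / p a :=
      Finset.sum_nonneg fun a _ => Finset.sum_nonneg fun b _ => (div_pos (hp b) (hp a)).le
    linarith
  set κ := 1 + ∑ a, ∑ b, p b / p a with hκ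
  have hle : ∀ a b, 1 + p b / p a ≤ κ := by
    intro a b
    have h1 : p b / p a ≤ ∑ b, p b / p a :=
      Finset.single_le_sum (f := fun b => p b / p a)
        (fun b _ => (div_pos (hp b) (hp a)).le) (Finset.mem_univ b)
    have h2 : ∑ b, p b / p a ≤ ∑ a, ∑ b, p b / p a :=
      Finset.single_le_sum (f := fun a => ∑ b, p b / p a)
        (fun a _ => Finset.sum_nonneg fun b _ => (div_pos (hp b) (hp a)).le) (Finset.mem_univ a)
    linarith
  have hκ0 : 0 ≤ κ := by
    have : 0 ≤ ∑ a, ∑ b, p b / p a :=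
      Finset.sum_nonneg fun a _ => Finset.sum_nonneg fun b _ => (div_pos (hp b) (hp a)).le
    linarith
  have hβ' : β ∈ Set.Icc (-1 : ℝ) 1 := ⟨by linarith [hβ.1], hβ.2⟩
  have hγ' : γ ∈ Set.Icc (-1 : ℝ) 1 := ⟨by linarith [hγ.1], hγ.2⟩
  refine boundP_le_mul_of_ratio hmodel hθ₀ hρ hest hG hU hU' hσ hp
    (fun x hx => betaFun_pos hβ' hx) (fun x hx => betaFun_pos hγ' hx) (by positivity)
    fun a b => ?_
  set x := p a / p b with hx
  have hx0 : 0 < x := div_pos (hp a) (hp b)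
  have hκx : x + 1 ≤ κ * x := by
    have h := mul_le_mul_of_nonneg_right (hle a b) hx0.le
    have : (1 + p b / p a) * x = x + 1 := by
      have := (hp a).ne'
      have := (hp b).ne'
      rw [hx]
      field_simp
    linarith
  have hd : betaFun β x - betaFun γ x ≤ |β - γ| * ((x + 1) / 2) := by
    have e : betaFun β x - betaFun γ x = (β - γ) * ((x - 1) / 2) := by
      simp only [betaFun]; ring
    rw [e]
    refine (le_abs_self _).trans ?_
    rw [abs_mul]
    refine mul_le_mul_of_nonneg_left ?_ (abs_nonneg _)
    exact abs_le.2 ⟨by linarith, by linarith⟩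
  have hlow : x / 2 ≤ betaFun γ x := by
    simp only [betaFun]
    nlinarith [hγ.1, hγ.2, mul_nonneg hγ.1 hx0.le]
  have h3 : (x + 1) / 2 ≤ κ * betaFun γ x := by
    have := mul_le_mul_of_nonneg_left hlow hκ0
    linarith
  have h4 := mul_le_mul_of_nonneg_left h3 (abs_nonneg (β - γ))
  linarith

theorem upperSemicontinuousOn_boundBeta (hmodel : IsSmoothModel Θ ρ) (hθ₀ : θ₀ ∈ interior Θ)
    (hρ : (ρ θ₀).PosDef) (hest : IsLocallyUnbiased ρ θ₀ M θhat) (hG : G.PosSemidef) :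
    UpperSemicontinuousOn (boundBeta ρ θ₀ G) (Set.Icc 0 1) := by
  obtain ⟨κ, -, h⟩ := exists_boundBeta_le_mul hmodel hθ₀ hρ hest hG
  intro γ hγ y hy
  have hlim : Filter.Tendsto (fun β => (1 + κ * |β - γ|) * boundBeta ρ θ₀ G γ)
      (nhdsWithin γ (Set.Icc 0 1)) (nhds ((1 + κ * |γ - γ|) * boundBeta ρ θ₀ G γ)) := by
    refine (Continuous.tendsto ?_ γ).mono_left nhdsWithin_le_nhds
    fun_prop
  rw [sub_self, abs_zero, mul_zero, add_zero, one_mul] at hlim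
  filter_upwards [hlim.eventually_lt_const hy, self_mem_nhdsWithin] with β hβ hβ'
  exact (h β hβ' γ hγ).trans_lt hβ

theorem isGreatest_maxLogDerivBound (hmodel : IsSmoothModel Θ ρ) (hθ₀ : θ₀ ∈ interior Θ)
    (hρ : (ρ θ₀).PosDef) (hest : IsLocallyUnbiased ρ θ₀ M θhat) (hG : G.PosSemidef) :
    IsGreatest (boundBeta ρ θ₀ G '' Set.Icc 0 1) (maxLogDerivBound ρ θ₀ G) := by
  obtain ⟨β, hβ, hmax⟩ := (upperSemicontinuousOn_boundBeta hmodel hθ₀ hρ hest hG).exists_isMaxOn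
    ⟨0, by simp⟩ isCompact_Icc
  have h : IsGreatest (boundBeta ρ θ₀ G '' Set.Icc 0 1) (boundBeta ρ θ₀ G β) := by
    refine ⟨⟨β, hβ, rfl⟩, ?_⟩
    rintro _ ⟨γ, hγ, rfl⟩
    exact hmax hγ
  rw [maxLogDerivBound, h.csSup_eq]
  exact h

end

end QuantumEstimation

theorem mainTheorem1 {n X : Type*} [Fintype n] [DecidableEq n] [Fintype X] {d : ℕ}
    (Θ : Set (Fin d → ℝ)) (ρ : (Fin d → ℝ) → Matrix n n ℂ) (θ₀ : Fin d → ℝ)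
    (hmodel : IsSmoothModel Θ ρ) (hθ₀ : θ₀ ∈ interior Θ) (hρ : (ρ θ₀).PosDef)
    (M : X → Matrix n n ℂ) (θhat : X → Fin d → ℝ) (hest : IsLocallyUnbiased ρ θ₀ M θhat)
    (G : Matrix (Fin d) (Fin d) ℝ) (hG : G.PosSemidef) :
    -- the chain of inequalities, all the inverses in it being genuine
    (∀ (P : ℝ → ℝ) (β : ℝ), IsOperatorMonotone P → P 1 = 1 → β ∈ Set.Icc (-1 : ℝ) 1 →
      HasDerivAt P ((1 + β) / 2) 1 →
        (classicalFisher ρ θ₀ M).PosDef ∧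
        (fisherInfo ρ θ₀ (betaFun |β|)).PosDef ∧
        (fisherInfo ρ θ₀ P).PosDef ∧
        (G * (classicalFisher ρ θ₀ M)⁻¹).trace ≤ (G * covMatrix ρ θ₀ M θhat).trace ∧
        boundBeta ρ θ₀ G |β| ≤ (G * (classicalFisher ρ θ₀ M)⁻¹).trace ∧
        boundP ρ θ₀ G P ≤ boundBeta ρ θ₀ G |β|) ∧
    -- the maximum is attained, bounds the weighted covariance and dominates every `C^{(P)}`
    IsGreatest (boundBeta ρ θ₀ G '' Set.Icc 0 1) (maxLogDerivBound ρ θ₀ G) ∧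
    maxLogDerivBound ρ θ₀ G ≤ (G * covMatrix ρ θ₀ M θhat).trace ∧
    (∀ P : ℝ → ℝ, IsOperatorMonotone P → P 1 = 1 →
      boundP ρ θ₀ G P ≤ maxLogDerivBound ρ θ₀ G) := by
  have habs : ∀ {β : ℝ}, β ∈ Set.Icc (-1 : ℝ) 1 → |β| ∈ Set.Icc (-1 : ℝ) 1 := fun hβ =>
    ⟨by linarith [abs_nonneg ‹ℝ›], abs_le.2 hβ⟩
  have hgreat := isGreatest_maxLogDerivBound hmodel hθ₀ hρ hest hG
  refine ⟨fun P β hP h1 hβ hd => ⟨posDef_classicalFisher hmodel hθ₀ hρ hest,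
    posDef_fisherInfo hmodel hθ₀ hρ hest fun x hx => betaFun_pos (habs hβ) hx,
    posDef_fisherInfo hmodel hθ₀ hρ hest hP.pos,
    trace_mul_inv_classicalFisher_le hmodel hθ₀ hρ hest hG,
    boundBeta_le_trace hmodel hθ₀ hρ hest hG (habs hβ), ?_⟩, hgreat, ?_, fun P hP h1 => ?_⟩
  · rw [boundBeta_abs hmodel hθ₀ hρ hest hG hβ]
    exact boundP_le_of_le hmodel hθ₀ hρ hest hG hP.pos (hP.le_betaFun h1 hd)
  · obtain ⟨β, hβ, h⟩ := hgreat.1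
    rw [← h]
    exact (boundBeta_le_trace hmodel hθ₀ hρ hest hG ⟨by linarith [hβ.1], hβ.2⟩).trans
      (trace_mul_inv_classicalFisher_le hmodel hθ₀ hρ hest hG)
  · obtain ⟨β, hβ, hle⟩ := hP.exists_le_betaFun h1
    refine (boundP_le_of_le hmodel hθ₀ hρ hest hG hP.pos hle).trans ?_
    change boundBeta ρ θ₀ G β ≤ _
    rw [← boundBeta_abs hmodel hθ₀ hρ hest hG hβ]
    exact hgreat.2 ⟨|β|, ⟨abs_nonneg β, abs_le.2 hβ⟩, rfl⟩
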